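/- Let $n, N$ be non-negative integers and let $X_1,\dots,X_N$ be independent (not necessarily identically distributed) random vectors in $\mathbb{R}^n$ which are isotropic, i.e. $\mathbb{E}\,X_iX_i^T = I$ for every $i$. Assume that the $X_i$ satisfy the strong regularity assumption: for some constants $C,\eta>0$ (the same for all $i$), one has, for every $i$ and every orthogonal projection $P$ in $\mathbb{R}^n$, $$\mathbb{P}\{\|PX_i\|_2^2 > t\} \le C\,t^{-1-\eta}\quad\text{for all } t > C\,\mathrm{rank}(P).$$ Let $\varepsilon\in(0,1)$ and suppose that $$N \ge C_{\mathrm{main}}\,\varepsilon^{-2-2/\eta}\, n,\qquad C_{\mathrm{main}} = 512\,(48C)^{2+2/\eta}\,(6+6/\eta)^{1+4/\eta}.$$ Then $$\mathbb{E}\,\Big\|\frac1N\sum_{i=1}^N X_iX_i^T - I\Big\| \le \varepsilon .$$ Here $\|\cdot\|$ is the spectral (operator) norm of a matrix and $\|\cdot\|_2$ is the Euclidean norm. (For $n=0$ the norm is $0$ and the claim is trivial.) -/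

import Mathlib

open MeasureTheory ProbabilityTheory

noncomputable section

namespace CovEst

/-- Euclidean space of dimension `n`, with the Euclidean norm. -/
abbrev Euc (n : ℕ) : Type := EuclideanSpace ℝ (Fin n)

/-- The rank-one matrix `x xᵀ`. -/
def outer {n : ℕ} (x : Euc n) : Matrix (Fin n) (Fin n) ℝ :=
  Matrix.of fun j k => x j * x k

/-- A random vector `X` is isotropic if `E X Xᵀ = I`; the expectation of a random matrix is
taken entrywise, and all entries are required to be integrable. -/
def IsIsotropic {n : ℕ} {Ω : Type*} [MeasurableSpace Ω] (μ : Measure Ω) (X : Ω → Euc n) : Prop :=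
  (∀ j k, Integrable (fun ω => outer (X ω) j k) μ) ∧
    (Matrix.of fun j k => ∫ ω, outer (X ω) j k ∂μ) = 1

/-- The strong regularity assumption with parameters `C` and `η`. An orthogonal projection is
a bounded operator `P` with `P² = P = P*`, and its rank is the dimension of its range. -/
def StrongRegularity {n : ℕ} {Ω : Type*} [MeasurableSpace Ω] (μ : Measure Ω) (C η : ℝ)
    (X : Ω → Euc n) : Prop :=
  ∀ P : Euc n →L[ℝ] Euc n, IsStarProjection P →
    ∀ t : ℝ, C * (Module.finrank ℝ (LinearMap.range (P : Euc n →ₗ[ℝ] Euc n)) : ℝ) < t →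
      μ.real {ω | t < ‖P (X ω)‖ ^ 2} ≤ C * t ^ (-1 - η)

/-- The sample covariance matrix `(1/N) ∑ xᵢ xᵢᵀ`. -/
def sampleCov {n N : ℕ} (x : Fin N → Euc n) : Matrix (Fin n) (Fin n) ℝ :=
  (1 / (N : ℝ)) • ∑ i, outer (x i)

/-- The spectral norm of a matrix: the norm of the operator it induces on Euclidean space. -/
def specNorm {n : ℕ} (A : Matrix (Fin n) (Fin n) ℝ) : ℝ :=
  ‖Matrix.toEuclideanCLM (n := Fin n) (𝕜 := ℝ) A‖

/-- The constant `512 (48 C)^(2+2/η) (6+6/η)^(1+4/η)`. -/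
def mainConst (C η : ℝ) : ℝ :=
  512 * (48 * C) ^ (2 + 2 / η) * (6 + 6 / η) ^ (1 + 4 / η)

end CovEst

end

/-! ### Rank-one updates of the resolvent -/

namespace CovEst

open Matrix

/-! The proof is a randomized barrier argument. The largest eigenvalue is replaced by the soft edge:
the least level `u` above the spectrum at which the trace of the resolvent is at most `φ`. It
dominates the top eigenvalue, is at most `n / φ` for the zero matrix, and moves in a controlled way
under a rank-one update. The barrier keeps every eigenvalue at distance at least `1 / φ` from `u`.

Let `h i` be the gaps from `u` to the eigenvalues and `y i` the coordinates of `x` in the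
eigenbasis. By Sherman–Morrison, adding `± x xᵀ` moves the edge by about `± Q`, where `Q` averages
`y i ^ 2` with weights proportional to `1 / h i ^ 2`, as long as `∑ y i ^ 2 / h i` and `φ * Q` are
at most a small `e`. Isotropy gives `E Q = 1`. Strong regularity, applied to groups of comparable
weights, gives these forms polynomial tails, so the exceptional event costs at most another `e`
(`integral_softEdge_add_outer_le`). Independence lets the step be iterated
(`integral_softEdge_sum_le`), so the edges of `∑ X_i X_iᵀ` and of its negative have means at most `n
/ φ + N (1 + 5e)` and `n / φ + N (-1 + 5e)`.

With `n / φ = e N`, the two edges divided by `N` sum to at most `12 e` in mean. This controls the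
spread of the spectrum of the sample covariance, not its position. One diagonal entry, whose mean
distance to `1` is at most `3 e` by truncation and a variance bound, pins the position
(`specNorm_sampleCov_sub_one_le`). The total is `15 e`, and `e = ε / 20`. -/

/-- `u` lies above the spectrum of `A` and the trace of the resolvent at `u` is at most `φ`. -/
def Feasible {n : ℕ} (φ : ℝ) (A : Matrix (Fin n) (Fin n) ℝ) (u : ℝ) : Prop :=
  (u • (1 : Matrix (Fin n) (Fin n) ℝ) - A).PosDef ∧
    (u • (1 : Matrix (Fin n) (Fin n) ℝ) - A)⁻¹.trace ≤ φ

/-- The soft upper spectral edge of `A` at sensitivity `φ`. -/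
noncomputable def softEdge {n : ℕ} (φ : ℝ) (A : Matrix (Fin n) (Fin n) ℝ) : ℝ :=
  sInf {u | Feasible φ A u}

/-- `G⁻¹ - H⁻¹` is the sum of `H⁻¹ (H - G) H⁻¹` and `(H⁻¹ - G⁻¹) G (H⁻¹ - G⁻¹)`, both positive
semidefinite. Neither square roots nor simultaneous diagonalization are needed. -/
theorem trace_inv_le_of_le {n : ℕ} {G H : Matrix (Fin n) (Fin n) ℝ} (hG : G.PosDef)
    (hH : H.PosDef) (hGH : (H - G).PosSemidef) : H⁻¹.trace ≤ G⁻¹.trace := by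
  have hGu : IsUnit G.det := (Matrix.isUnit_iff_isUnit_det _).1 hG.isUnit
  have hHu : IsUnit H.det := (Matrix.isUnit_iff_isUnit_det _).1 hH.isUnit
  have hHi : H⁻¹.IsHermitian := hH.inv.isHermitian
  have hGi : G⁻¹.IsHermitian := hG.inv.isHermitian
  have e1 : H⁻¹ᴴ * (H - G) * H⁻¹ = H⁻¹ - H⁻¹ * G * H⁻¹ := by
    rw [hHi.eq, mul_sub, sub_mul, Matrix.nonsing_inv_mul _ hHu, one_mul]
  have e2 : (H⁻¹ - G⁻¹)ᴴ * G * (H⁻¹ - G⁻¹) = H⁻¹ * G * H⁻¹ - H⁻¹ - H⁻¹ + G⁻¹ := by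
    rw [conjTranspose_sub, hHi.eq, hGi.eq, sub_mul, mul_sub, sub_mul, sub_mul,
      Matrix.nonsing_inv_mul _ hGu, one_mul, one_mul, mul_assoc H⁻¹ G G⁻¹,
      Matrix.mul_nonsing_inv _ hGu, mul_one]
    abel
  have h1 := (hGH.conjTranspose_mul_mul_same H⁻¹).trace_nonneg
  have h2 := (hG.posSemidef.conjTranspose_mul_mul_same (H⁻¹ - G⁻¹)).trace_nonneg
  rw [e1] at h1
  rw [e2] at h2
  simp only [trace_sub, trace_add] at h1 h2
  linarith

theorem sum_sq_lt_of_sum_div_lt {ι : Type*} [Fintype ι] {g y z : ι → ℝ} (hg : ∀ i, 0 < g i)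
    (hz : z ≠ 0) (hq : ∑ i, y i ^ 2 / g i < 1) :
    (∑ i, y i * z i) ^ 2 < ∑ i, g i * z i ^ 2 := by
  have hpos : 0 < ∑ i, g i * z i ^ 2 := by
    obtain ⟨i, hi⟩ := Function.ne_iff.1 hz
    refine Finset.sum_pos' (fun j _ => mul_nonneg (hg j).le (sq_nonneg _)) ⟨i, Finset.mem_univ _, ?_⟩
    have : z i ≠ 0 := hi
    have := hg i
    positivity
  have hcs : (∑ i, y i * z i) ^ 2 ≤ (∑ i, y i ^ 2 / g i) * ∑ i, g i * z i ^ 2 := by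
    apply Finset.sum_sq_le_sum_mul_sum_of_sq_le_mul
    · exact fun i _ => div_nonneg (sq_nonneg _) (hg i).le
    · exact fun i _ => mul_nonneg (hg i).le (sq_nonneg _)
    · intro i _
      have := (hg i).ne'
      refine le_of_eq ?_
      field_simp
  nlinarith

theorem posDef_diagonal_sub {ι : Type*} [Fintype ι] [DecidableEq ι] {g y : ι → ℝ} {s : ℝ}
    (hg : ∀ i, 0 < g i) (hs : s = 1 ∨ s = -1) (hq : s * ∑ i, y i ^ 2 / g i < 1) :
    (diagonal g - s • vecMulVec y y).PosDef := by
  refine Matrix.PosDef.of_dotProduct_mulVec_pos ?_ fun z hz => ?_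
  · ext i j
    rcases eq_or_ne i j with rfl | h
    · simp
    · simp [vecMulVec_apply, h, h.symm, mul_comm]
  · have e : star z ⬝ᵥ ((diagonal g - s • vecMulVec y y) *ᵥ z)
        = ∑ i, g i * z i ^ 2 - s * (∑ i, y i * z i) ^ 2 := by
      rw [sub_mulVec, dotProduct_sub, smul_mulVec, vecMulVec_mulVec]
      simp only [dotProduct, mulVec_diagonal, Pi.smul_apply, smul_eq_mul, star_trivial,
        MulOpposite.smul_eq_mul_unop, MulOpposite.unop_op]
      congr 1
      · exact Finset.sum_congr rfl fun i _ => by ring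
      · rw [sq, Finset.sum_mul, Finset.mul_sum]
        exact Finset.sum_congr rfl fun i _ => by ring
    rw [e]
    rcases hs with rfl | rfl
    · have := sum_sq_lt_of_sum_div_lt (y := y) hg hz (by simpa using hq)
      linarith
    -- With `y = 0` the strict inequality says only that the diagonal form is positive; the rank-one
    -- term has a favourable sign.
    · have := sum_sq_lt_of_sum_div_lt (y := 0) hg hz (by simp)
      simp at this
      nlinarith [sq_nonneg (∑ i, y i * z i)]

theorem diagonal_sub_mul_inv {ι : Type*} [Fintype ι] [DecidableEq ι] {g y : ι → ℝ} {s : ℝ}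
    (hg : ∀ i, 0 < g i) (hq : s * ∑ i, y i ^ 2 / g i < 1) :
    (diagonal g - s • vecMulVec y y) *
      (diagonal (fun i => 1 / g i) + (s / (1 - s * ∑ i, y i ^ 2 / g i)) •
        vecMulVec (fun i => y i / g i) (fun i => y i / g i)) = 1 := by
  set q := ∑ i, y i ^ 2 / g i with hqd
  have h0 : 1 - s * q ≠ 0 := by linarith
  have hd : diagonal g * diagonal (fun i => 1 / g i) = (1 : Matrix ι ι ℝ) := by
    rw [diagonal_mul_diagonal, ← diagonal_one]
    congr 1
    ext i
    have := (hg i).ne'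
    field_simp
  have h1 : diagonal g * vecMulVec (fun i => y i / g i) (fun i => y i / g i)
      = vecMulVec y (fun i => y i / g i) := by
    ext i j
    have := (hg i).ne'
    simp only [diagonal_mul, vecMulVec_apply]
    field_simp
  have h2 : vecMulVec y y * diagonal (fun i => 1 / g i) = vecMulVec y (fun i => y i / g i) := by
    ext i j
    simp only [mul_diagonal, vecMulVec_apply]
    ring
  have h3 : vecMulVec y y * vecMulVec (fun i => y i / g i) (fun i => y i / g i)
      = q • vecMulVec y (fun i => y i / g i) := by
    rw [vecMulVec_mul_vecMulVec]
    ext i j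
    have : y ⬝ᵥ (fun i => y i / g i) = q := by
      simp only [dotProduct, hqd]
      exact Finset.sum_congr rfl fun i _ => by ring
    simp only [this, vecMulVec_apply, Matrix.smul_apply, smul_eq_mul, Pi.smul_apply]
    ring
  rw [sub_mul, mul_add, mul_add, hd, Matrix.mul_smul, h1, Matrix.smul_mul, h2, Matrix.smul_mul,
    Matrix.mul_smul, h3]
  have hc : s / (1 - s * q) - (s + s * (s / (1 - s * q)) * q) = 0 := by
    field_simp
    ring
  rw [smul_smul, smul_smul, ← add_smul, add_sub_assoc, ← sub_smul, hc, zero_smul, add_zero]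

theorem outer_eq_vecMulVec {n : ℕ} (x : Euc n) : outer x = vecMulVec (⇑x) (⇑x) := rfl

/-- The Sherman–Morrison formula in the eigenbasis of `A`. -/
theorem posDef_and_trace_inv_add_outer {n : ℕ} {A : Matrix (Fin n) (Fin n) ℝ} (hA : A.IsHermitian)
    (x : Euc n) {u s : ℝ} (hs : s = 1 ∨ s = -1) (hg : ∀ i, 0 < u - hA.eigenvalues i)
    (hq : s * ∑ i, inner ℝ (hA.eigenvectorBasis i) x ^ 2 / (u - hA.eigenvalues i) < 1) :
    (u • (1 : Matrix (Fin n) (Fin n) ℝ) - (A + s • outer x)).PosDef ∧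
      (u • (1 : Matrix (Fin n) (Fin n) ℝ) - (A + s • outer x))⁻¹.trace =
        ∑ i, 1 / (u - hA.eigenvalues i) +
          s * (∑ i, inner ℝ (hA.eigenvectorBasis i) x ^ 2 / (u - hA.eigenvalues i) ^ 2) /
        (1 - s * ∑ i, inner ℝ (hA.eigenvectorBasis i) x ^ 2 / (u - hA.eigenvalues i)) := by
  set g : Fin n → ℝ := fun i => u - hA.eigenvalues i with hgd
  set y : Fin n → ℝ := fun i => inner ℝ (hA.eigenvectorBasis i) x with hyd
  set O : Matrix (Fin n) (Fin n) ℝ := (hA.eigenvectorUnitary : Matrix (Fin n) (Fin n) ℝ) with hO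
  have hOO : O * star O = 1 := Unitary.mul_star_self_of_mem hA.eigenvectorUnitary.2
  have hOO' : star O * O = 1 := Unitary.star_mul_self_of_mem hA.eigenvectorUnitary.2
  have hAd : A = O * diagonal hA.eigenvalues * star O := by
    have := hA.spectral_theorem
    rw [Unitary.conjStarAlgAut_apply] at this
    simpa using this
  have hy : star O *ᵥ (⇑x) = y := by
    ext i
    simp only [mulVec, dotProduct, hyd, hO, star_apply, IsHermitian.eigenvectorUnitary_apply,
      star_trivial]
    rw [PiLp.inner_apply]
    exact Finset.sum_congr rfl fun j _ => by simp [mul_comm]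
  have hx : (⇑x) = O *ᵥ y := by
    rw [← hy, mulVec_mulVec, hOO, one_mulVec]
  have hxx : outer x = O * vecMulVec y y * star O := by
    have hv : y ᵥ* star O = O *ᵥ y := by
      rw [← vecMul_transpose, star_eq_conjTranspose, conjTranspose_eq_transpose_of_trivial]
    rw [outer_eq_vecMulVec, mul_vecMulVec, vecMulVec_mul, hv, ← hx]
  have hfac : u • (1 : Matrix (Fin n) (Fin n) ℝ) - (A + s • outer x)
      = O * (diagonal g - s • vecMulVec y y) * star O := by
    have : diagonal g = u • (1 : Matrix (Fin n) (Fin n) ℝ) - diagonal hA.eigenvalues := by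
      ext i j
      by_cases h : i = j <;> simp [h, hgd, one_apply]
    rw [this, mul_sub, mul_sub, sub_mul, sub_mul, Matrix.mul_smul, mul_one, Matrix.smul_mul, hOO,
      ← hAd, Matrix.mul_smul, Matrix.smul_mul, ← hxx]
    abel
  have hpd := posDef_diagonal_sub (g := g) (y := y) hg hs hq
  have hinv := diagonal_sub_mul_inv (g := g) (y := y) hg hq
  set K := diagonal (fun i => 1 / g i) + (s / (1 - s * ∑ i, y i ^ 2 / g i)) •
        vecMulVec (fun i => y i / g i) (fun i => y i / g i) with hK
  constructor
  · rw [hfac]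
    have hu : IsUnit (star O) := IsUnit.of_mul_eq_one _ hOO'
    have := (Matrix.IsUnit.posDef_star_left_conjugate_iff hu).2 hpd
    rwa [star_star] at this
  · have : (u • (1 : Matrix (Fin n) (Fin n) ℝ) - (A + s • outer x))⁻¹ = O * K * star O := by
      apply inv_eq_right_inv
      rw [hfac]
      calc _ = O * ((diagonal g - s • vecMulVec y y) * ((star O * O) * K)) * star O := by
            noncomm_ring
        _ = 1 := by rw [hOO', one_mul, hinv, mul_one, hOO]
    rw [this, trace_mul_comm, ← mul_assoc, hOO', one_mul, hK, trace_add, trace_smul, trace_diagonal,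
      trace_vecMulVec]
    congr 1
    rw [smul_eq_mul, dotProduct, div_mul_eq_mul_div]
    congr 2
    exact Finset.sum_congr rfl fun i _ => by rw [← sq, div_pow]

end CovEst

/-! ### The soft edge: monotonicity, domination of the spectrum, continuity -/

namespace CovEst

open Matrix

variable {n : ℕ} {φ : ℝ} {A B : Matrix (Fin n) (Fin n) ℝ}

/-- A crude entrywise bound from `|z j * z k| ≤ ∑ z i ^ 2`. It supplies a feasible level for every
Hermitian matrix and makes the edge Lipschitz in the entries, hence continuous and measurable. -/
theorem posSemidef_sum_abs_smul_one_sub (hA : A.IsHermitian) :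
    ((∑ j, ∑ k, |A j k|) • (1 : Matrix (Fin n) (Fin n) ℝ) - A).PosSemidef := by
  refine Matrix.PosSemidef.of_dotProduct_mulVec_nonneg ?_ fun z => ?_
  · exact (isHermitian_one.smul (IsSelfAdjoint.all _)).sub hA
  · have hz : ∀ j k, z j * z k ≤ ∑ i, z i ^ 2 ∧ -(∑ i, z i ^ 2) ≤ z j * z k := by
      intro j k
      have hj : z j ^ 2 ≤ ∑ i, z i ^ 2 :=
        Finset.single_le_sum (f := fun i => z i ^ 2) (fun i _ => sq_nonneg _) (Finset.mem_univ j)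
      have hk : z k ^ 2 ≤ ∑ i, z i ^ 2 :=
        Finset.single_le_sum (f := fun i => z i ^ 2) (fun i _ => sq_nonneg _) (Finset.mem_univ k)
      constructor <;> nlinarith [sq_nonneg (z j - z k), sq_nonneg (z j + z k)]
    have e : star z ⬝ᵥ A *ᵥ z = ∑ j, ∑ k, A j k * (z j * z k) := by
      simp only [dotProduct, mulVec, star_trivial, Finset.mul_sum]
      exact Finset.sum_congr rfl fun j _ => Finset.sum_congr rfl fun k _ => by ring
    have e2 : star z ⬝ᵥ z = ∑ i, z i ^ 2 := by
      simp only [dotProduct, star_trivial]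
      exact Finset.sum_congr rfl fun j _ => by ring
    rw [sub_mulVec, dotProduct_sub, smul_mulVec, one_mulVec, dotProduct_smul, e, e2, smul_eq_mul,
      Finset.sum_mul, sub_nonneg]
    refine Finset.sum_le_sum fun j _ => ?_
    rw [Finset.sum_mul]
    refine Finset.sum_le_sum fun k _ => ?_
    calc A j k * (z j * z k) ≤ |A j k * (z j * z k)| := le_abs_self _
      _ = |A j k| * |z j * z k| := abs_mul _ _
      _ ≤ _ := mul_le_mul_of_nonneg_left (abs_le.2 ⟨(hz j k).2, (hz j k).1⟩) (abs_nonneg _)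

theorem Feasible.of_le {u c : ℝ} (h : Feasible φ B u)
    (hAB : (B + c • (1 : Matrix (Fin n) (Fin n) ℝ) - A).PosSemidef) : Feasible φ A (u + c) := by
  have e : (u + c) • (1 : Matrix (Fin n) (Fin n) ℝ) - A
      = (u • (1 : Matrix (Fin n) (Fin n) ℝ) - B) + (B + c • 1 - A) := by
    rw [add_smul]; abel
  have hp : ((u + c) • (1 : Matrix (Fin n) (Fin n) ℝ) - A).PosDef := by
    rw [e]; exact h.1.add_posSemidef hAB
  refine ⟨hp, (trace_inv_le_of_le h.1 hp ?_).trans h.2⟩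
  rw [e, add_sub_cancel_left]
  exact hAB

theorem feasible_of_le_smul_one [NeZero n] (hφ : 0 < φ) {c : ℝ}
    (hA : (c • (1 : Matrix (Fin n) (Fin n) ℝ) - A).PosSemidef) : Feasible φ A (n / φ + c) := by
  have hn : (0 : ℝ) < n := by exact_mod_cast Nat.pos_of_ne_zero (NeZero.ne n)
  have h0 : Feasible φ (0 : Matrix (Fin n) (Fin n) ℝ) (n / φ) := by
    have hp : (0 : ℝ) < n / φ := div_pos hn hφ
    refine ⟨by simpa using (Matrix.PosDef.one.smul hp), ?_⟩
    have : ((n / φ : ℝ) • (1 : Matrix (Fin n) (Fin n) ℝ) - 0)⁻¹ = (φ / n : ℝ) • 1 := by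
      apply inv_eq_right_inv
      rw [sub_zero, Matrix.smul_mul, one_mul, smul_smul]
      rw [show (n / φ * (φ / n) : ℝ) = 1 by field_simp, one_smul]
    rw [this, trace_smul, trace_one, Fintype.card_fin, smul_eq_mul]
    exact le_of_eq (by field_simp)
  exact h0.of_le (by simpa using hA)

theorem exists_feasible [NeZero n] (hφ : 0 < φ) (hA : A.IsHermitian) :
    {u | Feasible φ A u}.Nonempty :=
  ⟨_, feasible_of_le_smul_one hφ (posSemidef_sum_abs_smul_one_sub hA)⟩

/-- A feasible level exceeds every diagonal entry. This is where positive dimension matters: for `n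
= 0` every real number can be feasible. -/
theorem bddBelow_feasible [NeZero n] : BddBelow {u | Feasible φ A u} := by
  refine ⟨A 0 0, fun u hu => ?_⟩
  have := hu.1.diag_pos (i := 0)
  simp at this
  exact this.le

theorem softEdge_le [NeZero n] {u : ℝ} (h : Feasible φ A u) : softEdge φ A ≤ u :=
  csInf_le bddBelow_feasible h

theorem softEdge_le_add [NeZero n] (hφ : 0 < φ) (hB : B.IsHermitian) {c : ℝ}
    (hAB : (B + c • (1 : Matrix (Fin n) (Fin n) ℝ) - A).PosSemidef) :
    softEdge φ A ≤ softEdge φ B + c := by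
  rw [← sub_le_iff_le_add]
  refine le_csInf (exists_feasible hφ hB) fun u hu => ?_
  rw [sub_le_iff_le_add]
  exact softEdge_le (Feasible.of_le hu hAB)

theorem softEdge_zero_le [NeZero n] (hφ : 0 < φ) :
    softEdge φ (0 : Matrix (Fin n) (Fin n) ℝ) ≤ n / φ := by
  have := softEdge_le (feasible_of_le_smul_one (A := (0 : Matrix (Fin n) (Fin n) ℝ)) (c := 0) hφ
    (by simpa using Matrix.PosSemidef.zero))
  simpa using this

theorem posSemidef_softEdge_sub [NeZero n] (hφ : 0 < φ) (hA : A.IsHermitian) :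
    (softEdge φ A • (1 : Matrix (Fin n) (Fin n) ℝ) - A).PosSemidef := by
  refine Matrix.PosSemidef.of_dotProduct_mulVec_nonneg ?_ fun z => ?_
  · exact (isHermitian_one.smul (IsSelfAdjoint.all _)).sub hA
  rcases eq_or_ne z 0 with rfl | hz
  · simp
  have hzz : 0 < star z ⬝ᵥ z := dotProduct_star_self_pos_iff.2 hz
  -- Every Rayleigh quotient is a lower bound for the feasible levels, so it passes to the infimum
  -- without knowing that the infimum is attained.
  have key : (star z ⬝ᵥ A *ᵥ z) / (star z ⬝ᵥ z) ≤ softEdge φ A := by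
    refine le_csInf (exists_feasible hφ hA) fun u hu => ?_
    have := hu.1.dotProduct_mulVec_pos hz
    rw [sub_mulVec, dotProduct_sub, smul_mulVec, one_mulVec, dotProduct_smul, smul_eq_mul] at this
    rw [div_le_iff₀ hzz]
    linarith
  rw [div_le_iff₀ hzz] at key
  rw [sub_mulVec, dotProduct_sub, smul_mulVec, one_mulVec, dotProduct_smul, smul_eq_mul]
  linarith

theorem abs_softEdge_sub_le [NeZero n] (hφ : 0 < φ) (hA : A.IsHermitian) (hB : B.IsHermitian) :
    |softEdge φ A - softEdge φ B| ≤ ∑ j, ∑ k, |A j k - B j k| := by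
  have h : ∀ {A B : Matrix (Fin n) (Fin n) ℝ}, A.IsHermitian → B.IsHermitian →
      softEdge φ A ≤ softEdge φ B + ∑ j, ∑ k, |A j k - B j k| := by
    intro A B hA hB
    refine softEdge_le_add hφ hB ?_
    have := posSemidef_sum_abs_smul_one_sub (hA.sub hB)
    simp only [Matrix.sub_apply] at this
    convert this using 1
    abel
  rw [abs_le]
  have h1 := h hA hB
  have h2 := h hB hA
  simp only [abs_sub_comm (B _ _)] at h2
  constructor <;> linarith

theorem outer_isHermitian (x : Euc n) : (outer x).IsHermitian := by
  ext i j
  simp [outer, mul_comm]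

theorem posSemidef_outer (x : Euc n) : (outer x).PosSemidef := by
  have := posSemidef_vecMulVec_self_star (⇑x)
  rwa [star_trivial, ← outer_eq_vecMulVec] at this

theorem dotProduct_outer_mulVec (x : Euc n) (z : Fin n → ℝ) :
    star z ⬝ᵥ outer x *ᵥ z = (⇑x ⬝ᵥ z) ^ 2 := by
  rw [outer_eq_vecMulVec, vecMulVec_mulVec, dotProduct_smul, star_trivial, dotProduct_comm z]
  simp [sq]

theorem posSemidef_norm_sq_smul_one_sub_outer (x : Euc n) :
    (‖x‖ ^ 2 • (1 : Matrix (Fin n) (Fin n) ℝ) - outer x).PosSemidef := by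
  refine Matrix.PosSemidef.of_dotProduct_mulVec_nonneg ?_ fun z => ?_
  · exact (isHermitian_one.smul (IsSelfAdjoint.all _)).sub (outer_isHermitian x)
  rw [sub_mulVec, dotProduct_sub, smul_mulVec, one_mulVec, dotProduct_smul,
    dotProduct_outer_mulVec, smul_eq_mul, EuclideanSpace.real_norm_sq_eq, sub_nonneg]
  simp only [dotProduct, star_trivial]
  simp only [← sq]
  exact Finset.sum_mul_sq_le_sq_mul_sq _ _ _

theorem sub_eigenvalues_pos (hA : A.IsHermitian) {u : ℝ} (h : Feasible φ A u) (i : Fin n) :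
    0 < u - hA.eigenvalues i := by
  set v := hA.eigenvectorBasis i with hv
  have hn : ‖v‖ = 1 := hA.eigenvectorBasis.orthonormal.1 i
  have hv0 : (⇑v : Fin n → ℝ) ≠ 0 := by
    intro h0
    have : v = 0 := by ext j; exact congrFun h0 j
    simp [this] at hn
  have := h.1.dotProduct_mulVec_pos hv0
  rw [sub_mulVec, dotProduct_sub, smul_mulVec, one_mulVec, dotProduct_smul, smul_eq_mul,
    hA.mulVec_eigenvectorBasis, dotProduct_smul, smul_eq_mul, ← sub_mul] at this
  have h1 : star (⇑v : Fin n → ℝ) ⬝ᵥ ⇑v = 1 := by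
    have := EuclideanSpace.real_norm_sq_eq v
    rw [hn] at this
    simp only [dotProduct, star_trivial, ← sq]
    linarith
  rw [h1] at this
  linarith

theorem sum_one_div_le (hA : A.IsHermitian) {u : ℝ} (h : Feasible φ A u) :
    ∑ i, 1 / (u - hA.eigenvalues i) ≤ φ := by
  -- The zero update writes the trace of the resolvent itself in terms of the eigenvalues.
  have := (posDef_and_trace_inv_add_outer hA 0 (s := 1) (Or.inl rfl) (sub_eigenvalues_pos hA h)
    (by simp)).2
  have e : outer (0 : Euc n) = 0 := by ext; simp [outer]
  simp only [e, smul_zero, add_zero, inner_zero_right, ne_eq, OfNat.ofNat_ne_zero,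
    not_false_eq_true, zero_pow, zero_div, Finset.sum_const_zero, mul_zero] at this
  rw [← this]
  exact h.2

end CovEst

/-! ### Deterministic shifts of the edge under a rank-one update -/

namespace CovEst

section Sums

variable {ι : Type*} [Fintype ι] {h y : ι → ℝ}

/-- The convex function `1 / x` lies above its tangent at `h i + Δ`, so moving the barrier by `Δ`
gains at least `Δ * ∑ 1 / (h i + Δ) ^ 2` of trace; `hQ` says that this pays for the Sherman–Morrison
term. The argument works for either sign of `Δ`, hence for both updates. -/
theorem sum_one_div_add_le {Δ s : ℝ} (hh : ∀ i, 0 < h i) (hΔ : ∀ i, 0 < h i + Δ)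
    (hq : s * ∑ i, y i ^ 2 / (h i + Δ) < 1)
    (hQ : s * ∑ i, y i ^ 2 / (h i + Δ) ^ 2 ≤
      Δ * (1 - s * ∑ i, y i ^ 2 / (h i + Δ)) * ∑ i, 1 / (h i + Δ) ^ 2) :
    ∑ i, 1 / (h i + Δ) + s * (∑ i, y i ^ 2 / (h i + Δ) ^ 2) /
      (1 - s * ∑ i, y i ^ 2 / (h i + Δ)) ≤ ∑ i, 1 / h i := by
  have h1 : s * (∑ i, y i ^ 2 / (h i + Δ) ^ 2) / (1 - s * ∑ i, y i ^ 2 / (h i + Δ)) ≤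
      Δ * ∑ i, 1 / (h i + Δ) ^ 2 := by
    rw [div_le_iff₀ (by linarith)]
    linarith
  have h2 : ∑ i, 1 / (h i + Δ) + Δ * ∑ i, 1 / (h i + Δ) ^ 2 ≤ ∑ i, 1 / h i := by
    rw [Finset.mul_sum, ← Finset.sum_add_distrib]
    refine Finset.sum_le_sum fun i _ => ?_
    have e : 1 / h i - (1 / (h i + Δ) + Δ * (1 / (h i + Δ) ^ 2))
        = Δ ^ 2 / (h i * (h i + Δ) ^ 2) := by
      have := (hh i).ne'
      have := (hΔ i).ne'
      field_simp
      ring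
    have : 0 ≤ Δ ^ 2 / (h i * (h i + Δ) ^ 2) :=
      div_nonneg (sq_nonneg _) (mul_nonneg (hh i).le (sq_nonneg _))
    linarith
  linarith

/-- The quadratic form with weights proportional to `h⁻²` and total weight one. -/
noncomputable def normalizedForm (h y : ι → ℝ) : ℝ :=
  (∑ i, y i ^ 2 / h i ^ 2) / ∑ i, 1 / h i ^ 2

theorem normalizedForm_nonneg : 0 ≤ normalizedForm h y :=
  div_nonneg (Finset.sum_nonneg fun _ _ => div_nonneg (sq_nonneg _) (sq_nonneg _))
    (Finset.sum_nonneg fun _ _ => div_nonneg zero_le_one (sq_nonneg _))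

theorem sum_one_div_sq_pos [Nonempty ι] (hh : ∀ i, 0 < h i) : 0 < ∑ i, 1 / h i ^ 2 :=
  Finset.sum_pos (fun i _ => by have := hh i; positivity) Finset.univ_nonempty

theorem sum_sq_div_sq_eq [Nonempty ι] (hh : ∀ i, 0 < h i) :
    ∑ i, y i ^ 2 / h i ^ 2 = normalizedForm h y * ∑ i, 1 / h i ^ 2 := by
  rw [normalizedForm, div_mul_cancel₀ _ (sum_one_div_sq_pos hh).ne']

theorem one_le_mul_of_sum_le {φ : ℝ} (hh : ∀ i, 0 < h i) (hφ : ∑ i, 1 / h i ≤ φ) (i : ι) :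
    1 ≤ φ * h i := by
  have := (Finset.single_le_sum (f := fun i => 1 / h i)
    (fun j _ => (one_div_pos.2 (hh j)).le) (Finset.mem_univ i)).trans hφ
  exact (div_le_iff₀ (hh i)).1 this

/-- The required inequality involves the shifted gaps `h i + Δ`, while `Q` uses `h i`. Since `h i ≥
1 / φ`, the two differ by a factor at most `κ = 1 + Δ φ`, which is close to one; the slack `4 e`
absorbs `κ ^ 2` and the denominator `1 - e`. -/
theorem upper_shift_valid [Nonempty ι] {φ e : ℝ} (hh : ∀ i, 0 < h i) (hφ : ∑ i, 1 / h i ≤ φ)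
    (he0 : 0 < e) (he : e ≤ 1 / 20) (hq : ∑ i, y i ^ 2 / h i ≤ e)
    (hQ : normalizedForm h y * φ ≤ e) {Δ : ℝ} (hΔ : Δ = (1 + 4 * e) * normalizedForm h y) :
    ∑ i, y i ^ 2 / (h i + Δ) < 1 ∧
    ∑ i, y i ^ 2 / (h i + Δ) ^ 2 ≤
      Δ * (1 - ∑ i, y i ^ 2 / (h i + Δ)) * ∑ i, 1 / (h i + Δ) ^ 2 := by
  set Q := normalizedForm h y with hQd
  have hQ0 : 0 ≤ Q := normalizedForm_nonneg
  have hΔ0 : 0 ≤ Δ := by rw [hΔ]; positivity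
  have hhΔ : ∀ i, 0 < h i + Δ := fun i => add_pos_of_pos_of_nonneg (hh i) hΔ0
  have hqΔ : ∑ i, y i ^ 2 / (h i + Δ) ≤ e := by
    refine le_trans (Finset.sum_le_sum fun i _ => ?_) hq
    have := hh i
    gcongr
    linarith
  have hQΔ : ∑ i, y i ^ 2 / (h i + Δ) ^ 2 ≤ Q * ∑ i, 1 / h i ^ 2 := by
    rw [hQd, ← sum_sq_div_sq_eq hh]
    refine Finset.sum_le_sum fun i _ => ?_
    have := hh i
    gcongr
    linarith
  have hφ0 : 0 ≤ φ := (Finset.sum_nonneg fun i _ => (one_div_pos.2 (hh i)).le).trans hφ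
  set κ := 1 + Δ * φ with hκ
  have hκ0 : 0 < κ := by positivity
  have hD : ∑ i, 1 / h i ^ 2 ≤ κ ^ 2 * ∑ i, 1 / (h i + Δ) ^ 2 := by
    rw [Finset.mul_sum]
    refine Finset.sum_le_sum fun i _ => ?_
    have h1 := one_le_mul_of_sum_le hh hφ i
    have h2 := hh i
    have h3 := hhΔ i
    have h4 : h i + Δ ≤ κ * h i := by rw [hκ]; nlinarith
    rw [mul_one_div, div_le_div_iff₀ (by positivity) (by positivity), one_mul, ← mul_pow]
    gcongr
  have hκ1 : κ ≤ 1 + 1.2 * e := by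
    have : Δ * φ = (1 + 4 * e) * (Q * φ) := by rw [hΔ]; ring
    rw [hκ, this]
    nlinarith [mul_nonneg hQ0 hφ0]
  have hκ2 : κ ^ 2 ≤ (1 + 4 * e) * (1 - e) := by nlinarith
  have hDΔ : 0 ≤ ∑ i, 1 / (h i + Δ) ^ 2 :=
    Finset.sum_nonneg fun i _ => div_nonneg zero_le_one (sq_nonneg _)
  refine ⟨by linarith, hQΔ.trans ?_⟩
  calc Q * ∑ i, 1 / h i ^ 2 ≤ Q * (κ ^ 2 * ∑ i, 1 / (h i + Δ) ^ 2) := by gcongr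
    _ ≤ Q * (((1 + 4 * e) * (1 - e)) * ∑ i, 1 / (h i + Δ) ^ 2) := by gcongr
    _ = Δ * (1 - e) * ∑ i, 1 / (h i + Δ) ^ 2 := by rw [hΔ]; ring
    _ ≤ _ := by gcongr

/-- Here the gaps shrink by a factor at least `1 - e`. The slack `3 e` is what `1 - 3 e ≤ (1 - e) ^
3` requires: two factors from the squared gaps, one from `1 + e / (1 - e) = 1 / (1 - e)`. -/
theorem lower_shift_valid [Nonempty ι] {φ e : ℝ} (hh : ∀ i, 0 < h i) (hφ : ∑ i, 1 / h i ≤ φ)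
    (he0 : 0 < e) (he : e ≤ 1 / 20) (hq : ∑ i, y i ^ 2 / h i ≤ e)
    (hQ : normalizedForm h y * φ ≤ e) {δ : ℝ} (hδ : δ = (1 - 3 * e) * normalizedForm h y) :
    (∀ i, 0 < h i - δ) ∧
    δ * (1 + ∑ i, y i ^ 2 / (h i - δ)) * ∑ i, 1 / (h i - δ) ^ 2 ≤
      ∑ i, y i ^ 2 / (h i - δ) ^ 2 := by
  set Q := normalizedForm h y with hQd
  have hQ0 : 0 ≤ Q := normalizedForm_nonneg
  have hδ0 : 0 ≤ δ := by rw [hδ]; exact mul_nonneg (by linarith) hQ0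
  have hφ0 : 0 ≤ φ := (Finset.sum_nonneg fun i _ => (one_div_pos.2 (hh i)).le).trans hφ
  have hδφ : δ * φ ≤ e := by
    have : δ * φ = (1 - 3 * e) * (Q * φ) := by rw [hδ]; ring
    rw [this]
    nlinarith [mul_nonneg hQ0 hφ0]
  have hlow : ∀ i, (1 - e) * h i ≤ h i - δ := fun i => by
    have h1 := one_le_mul_of_sum_le hh hφ i
    have h2 := hh i
    nlinarith
  have he1 : 0 < 1 - e := by linarith
  have hhδ : ∀ i, 0 < h i - δ := fun i => (mul_pos he1 (hh i)).trans_le (hlow i)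
  have hqδ : ∑ i, y i ^ 2 / (h i - δ) ≤ e / (1 - e) := by
    have : ∑ i, y i ^ 2 / (h i - δ) ≤ ∑ i, (y i ^ 2 / h i) / (1 - e) := by
      refine Finset.sum_le_sum fun i _ => ?_
      rw [div_div, mul_comm]
      have := mul_pos he1 (hh i)
      gcongr
      exact hlow i
    rw [← Finset.sum_div] at this
    exact this.trans (by gcongr)
  have hQδ : Q * ∑ i, 1 / h i ^ 2 ≤ ∑ i, y i ^ 2 / (h i - δ) ^ 2 := by
    rw [hQd, ← sum_sq_div_sq_eq hh]
    refine Finset.sum_le_sum fun i _ => ?_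
    have := hhδ i
    gcongr
    linarith
  have hD : (1 - e) ^ 2 * ∑ i, 1 / (h i - δ) ^ 2 ≤ ∑ i, 1 / h i ^ 2 := by
    rw [Finset.mul_sum]
    refine Finset.sum_le_sum fun i _ => ?_
    have h2 := hh i
    have h3 := hhδ i
    rw [mul_one_div, div_le_div_iff₀ (by positivity) (by positivity), one_mul, ← mul_pow]
    have := hlow i
    gcongr
  have hDδ : 0 ≤ ∑ i, 1 / (h i - δ) ^ 2 :=
    Finset.sum_nonneg fun i _ => div_nonneg zero_le_one (sq_nonneg _)
  have hnum : (1 - 3 * e) * (1 + e / (1 - e)) ≤ (1 - e) ^ 2 := by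
    have : 1 + e / (1 - e) = 1 / (1 - e) := by field_simp; ring
    rw [this, mul_one_div, div_le_iff₀ he1]
    nlinarith [mul_pos he0 he0, mul_pos (mul_pos he0 he0) he0]
  refine ⟨hhδ, le_trans ?_ hQδ⟩
  calc δ * (1 + ∑ i, y i ^ 2 / (h i - δ)) * ∑ i, 1 / (h i - δ) ^ 2
      ≤ δ * (1 + e / (1 - e)) * ∑ i, 1 / (h i - δ) ^ 2 := by gcongr
    _ = Q * (((1 - 3 * e) * (1 + e / (1 - e))) * ∑ i, 1 / (h i - δ) ^ 2) := by rw [hδ]; ring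
    _ ≤ Q * ((1 - e) ^ 2 * ∑ i, 1 / (h i - δ) ^ 2) := by gcongr
    _ ≤ _ := by gcongr

end Sums

variable {n : ℕ} {φ : ℝ} {A : Matrix (Fin n) (Fin n) ℝ}

theorem softEdge_add_outer_le [NeZero n] (hA : A.IsHermitian) {u : ℝ} (hu : Feasible φ A u)
    (x : Euc n) {s Δ : ℝ} (hs : s = 1 ∨ s = -1) {h y : Fin n → ℝ}
    (hh : h = fun i => u - hA.eigenvalues i)
    (hy : y = fun i => inner ℝ (hA.eigenvectorBasis i) x) (hΔ : ∀ i, 0 < h i + Δ)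
    (hq : s * ∑ i, y i ^ 2 / (h i + Δ) < 1)
    (hQ : s * ∑ i, y i ^ 2 / (h i + Δ) ^ 2 ≤
      Δ * (1 - s * ∑ i, y i ^ 2 / (h i + Δ)) * ∑ i, 1 / (h i + Δ) ^ 2) :
    softEdge φ (A + s • outer x) ≤ u + Δ := by
  have e : ∀ i, u + Δ - hA.eigenvalues i = h i + Δ := fun i => by rw [hh]; ring
  have hpos : ∀ i, 0 < h i := by rw [hh]; exact sub_eigenvalues_pos hA hu
  have hy' : ∀ i, inner ℝ (hA.eigenvectorBasis i) x = y i := fun i => by rw [hy]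
  have := posDef_and_trace_inv_add_outer hA x (u := u + Δ) hs (by simpa only [e] using hΔ)
    (by simpa only [e, hy'] using hq)
  refine softEdge_le ⟨this.1, ?_⟩
  rw [this.2]
  simp only [e, hy']
  refine (sum_one_div_add_le hpos hΔ hq hQ).trans ?_
  rw [hh]
  exact sum_one_div_le hA hu

theorem softEdge_add_outer_le_normalizedForm [NeZero n] (hA : A.IsHermitian) {u : ℝ}
    (hu : Feasible φ A u) (x : Euc n) {e : ℝ} (he0 : 0 < e) (he : e ≤ 1 / 20) {h y : Fin n → ℝ}
    (hh : h = fun i => u - hA.eigenvalues i)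
    (hy : y = fun i => inner ℝ (hA.eigenvectorBasis i) x)
    (hq : ∑ i, y i ^ 2 / h i ≤ e) (hQ : normalizedForm h y * φ ≤ e) :
    softEdge φ (A + outer x) ≤ u + (1 + 4 * e) * normalizedForm h y := by
  have hpos : ∀ i, 0 < h i := by rw [hh]; exact sub_eigenvalues_pos hA hu
  have hφ : ∑ i, 1 / h i ≤ φ := by rw [hh]; exact sum_one_div_le hA hu
  have hv := upper_shift_valid hpos hφ he0 he hq hQ rfl
  have := softEdge_add_outer_le hA hu x (s := 1) (Or.inl rfl) hh hy
    (Δ := (1 + 4 * e) * normalizedForm h y)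
    (fun i => add_pos_of_pos_of_nonneg (hpos i)
      (mul_nonneg (by linarith) normalizedForm_nonneg))
    (by simpa only [one_mul] using hv.1) (by simpa only [one_mul] using hv.2)
  simpa only [one_smul] using this

/-- The version for large updates: no smallness of `φ * Q` is assumed, at the price of evaluating
both forms at gaps already enlarged by `t`. It gives the tail of the edge increment. -/
theorem softEdge_add_outer_le_of_form_le [NeZero n] (hA : A.IsHermitian) {u : ℝ}
    (hu : Feasible φ A u) (x : Euc n) {t : ℝ} (ht : 0 < t) {h y : Fin n → ℝ}
    (hh : h = fun i => u - hA.eigenvalues i)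
    (hy : y = fun i => inner ℝ (hA.eigenvectorBasis i) x)
    (hq : ∑ i, y i ^ 2 / (h i + t) ≤ 1 / 2)
    (hQ : normalizedForm (fun i => h i + t) y ≤ t / 2) :
    softEdge φ (A + outer x) ≤ u + t := by
  have hpos : ∀ i, 0 < h i := by rw [hh]; exact sub_eigenvalues_pos hA hu
  have hpos' : ∀ i, 0 < h i + t := fun i => add_pos (hpos i) ht
  have := softEdge_add_outer_le hA hu x (s := 1) (Or.inl rfl) hh hy (Δ := t) hpos'
    (by linarith) (by
      rw [one_mul, one_mul, sum_sq_div_sq_eq (h := fun i => h i + t) hpos']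
      have := sum_one_div_sq_pos hpos'
      gcongr
      nlinarith)
  simpa only [one_smul] using this

theorem softEdge_sub_outer_le_normalizedForm [NeZero n] (hA : A.IsHermitian) {u : ℝ}
    (hu : Feasible φ A u) (x : Euc n) {e : ℝ} (he0 : 0 < e) (he : e ≤ 1 / 20) {h y : Fin n → ℝ}
    (hh : h = fun i => u - hA.eigenvalues i)
    (hy : y = fun i => inner ℝ (hA.eigenvectorBasis i) x)
    (hq : ∑ i, y i ^ 2 / h i ≤ e) (hQ : normalizedForm h y * φ ≤ e) :
    softEdge φ (A + (-1 : ℝ) • outer x) ≤ u - (1 - 3 * e) * normalizedForm h y := by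
  have hpos : ∀ i, 0 < h i := by rw [hh]; exact sub_eigenvalues_pos hA hu
  have hφ : ∑ i, 1 / h i ≤ φ := by rw [hh]; exact sum_one_div_le hA hu
  obtain ⟨h1, h2⟩ := lower_shift_valid hpos hφ he0 he hq hQ rfl
  have := softEdge_add_outer_le hA hu x (s := -1) (Or.inr rfl) hh hy
    (Δ := -((1 - 3 * e) * normalizedForm h y)) (by simpa only [← sub_eq_add_neg] using h1)
    (by
      have : 0 ≤ ∑ i, y i ^ 2 / (h i + -((1 - 3 * e) * normalizedForm h y)) :=
        Finset.sum_nonneg fun i _ => div_nonneg (sq_nonneg _) (by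
          have := h1 i; linarith)
      linarith)
    (by
      simp only [← sub_eq_add_neg]
      linarith)
  simpa only [sub_eq_add_neg] using this

theorem softEdge_sub_outer_le [NeZero n] (hφ : 0 < φ) (hA : A.IsHermitian) (x : Euc n) :
    softEdge φ (A + (-1 : ℝ) • outer x) ≤ softEdge φ A := by
  have := softEdge_le_add (A := A + (-1 : ℝ) • outer x) (c := 0) hφ hA (by
    have := posSemidef_outer x
    simpa using this)
  simpa using this

end CovEst

/-! ### Tails of quadratic forms under strong regularity -/

namespace CovEst

section Tail

variable {Ω : Type*} [MeasurableSpace Ω] {μ : Measure Ω}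

theorem integral_rpow_add_Ioi {T η : ℝ} (hT : 0 < T) (hη : 0 < η) :
    IntegrableOn (fun t : ℝ => (t + T) ^ (-1 - η)) (Set.Ioi 0) ∧
      ∫ t in Set.Ioi (0 : ℝ), (t + T) ^ (-1 - η) = T ^ (-η) / η := by
  have hint : IntegrableOn (fun t : ℝ => (t + T) ^ (-1 - η)) (Set.Ioi 0) :=
    integrableOn_add_rpow_Ioi_of_lt (by linarith) (by linarith)
  refine ⟨hint, ?_⟩
  have hd : ∀ x ∈ Set.Ici (0 : ℝ),
      HasDerivAt (fun t : ℝ => -((t + T) ^ (-η) / η)) ((x + T) ^ (-1 - η)) x := by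
    intro x hx
    have hx0 : (0 : ℝ) ≤ x := hx
    have h1 := (((hasDerivAt_id x).add_const T).rpow_const (p := -η)
      (Or.inl (by simp only [id]; linarith))).div_const η |>.neg
    refine HasDerivAt.congr_deriv (f' := -(1 * -η * (x + T) ^ (-η - 1) / η)) h1 ?_
    rw [show -η - 1 = -1 - η by ring]
    field_simp
  have ht : Filter.Tendsto (fun t : ℝ => -((t + T) ^ (-η) / η)) Filter.atTop (nhds 0) := by
    have h1 := (tendsto_rpow_neg_atTop hη).comp
      (Filter.tendsto_atTop_add_const_right Filter.atTop T Filter.tendsto_id)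
    have h2 := (h1.div_const η).neg
    simpa using h2
  rw [integral_Ioi_of_hasDerivAt_of_tendsto' hd hint ht]
  simp

/-- The expected excess over `T` of a random variable with a polynomial tail beyond `T`. -/
theorem integral_excess_le [IsFiniteMeasure μ] {Y : Ω → ℝ} (hY : Measurable Y) {D T η : ℝ}
    (hD : 0 ≤ D) (hT : 0 < T) (hη : 0 < η)
    (htail : ∀ t, T ≤ t → μ.real {ω | t < Y ω} ≤ D * t ^ (-1 - η)) :
    Integrable (fun ω => max (Y ω - T) 0) μ ∧
      ∫ ω, max (Y ω - T) 0 ∂μ ≤ D * T ^ (-η) / η := by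
  have hm : Measurable fun ω => max (Y ω - T) 0 := (hY.sub_const T).max measurable_const
  have hnn : 0 ≤ᵐ[μ] fun ω => max (Y ω - T) 0 := ae_of_all _ fun ω => le_max_right _ _
  obtain ⟨hint, hval⟩ := integral_rpow_add_Ioi hT hη
  have hlint : ∫⁻ ω, ENNReal.ofReal (max (Y ω - T) 0) ∂μ ≤ ENNReal.ofReal (D * T ^ (-η) / η) := by
    rw [lintegral_eq_lintegral_meas_lt μ hnn hm.aemeasurable]
    have hr : D * T ^ (-η) / η = ∫ t in Set.Ioi (0 : ℝ), D * (t + T) ^ (-1 - η) := by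
      rw [integral_const_mul, hval]; ring
    rw [hr, ofReal_integral_eq_lintegral_ofReal (hint.const_mul D)]
    · refine setLIntegral_mono' measurableSet_Ioi fun t ht => ?_
      have ht0 : (0 : ℝ) < t := ht
      have hset : {ω | t < max (Y ω - T) 0} = {ω | t + T < Y ω} := by
        ext ω
        simp only [Set.mem_ofPred_eq, lt_max_iff]
        constructor
        · rintro (h | h) <;> linarith
        · intro h; left; linarith
      rw [hset]
      have := htail (t + T) (by linarith)
      rw [Measure.real] at this
      rw [← ENNReal.ofReal_toReal (measure_ne_top μ {ω | t + T < Y ω})]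
      exact ENNReal.ofReal_le_ofReal this
    · filter_upwards [ae_restrict_mem measurableSet_Ioi] with t ht
      have ht0 : (0 : ℝ) < t := ht
      exact mul_nonneg hD (Real.rpow_nonneg (by linarith) _)
  have hi : Integrable (fun ω => max (Y ω - T) 0) μ := by
    refine ⟨hm.aestronglyMeasurable, ?_⟩
    rw [hasFiniteIntegral_iff_ofReal hnn]
    exact hlint.trans_lt ENNReal.ofReal_lt_top
  refine ⟨hi, ?_⟩
  rw [integral_eq_lintegral_of_nonneg_ae hnn hm.aestronglyMeasurable]
  refine ENNReal.toReal_le_of_le_ofReal ?_ hlint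
  have := Real.rpow_nonneg hT.le (-η)
  positivity

variable {n : ℕ} {X : Ω → Euc n} {C η : ℝ} {ι : Type*}

theorem StrongRegularity.measureReal_sum_inner_sq [IsFiniteMeasure μ]
    (hSR : StrongRegularity μ C η X) (hC : 0 < C) {v : ι → Euc n} (hv : Orthonormal ℝ v)
    (J : Finset ι) {t : ℝ} (ht : C * J.card < t) :
    μ.real {ω | t < ∑ i ∈ J, inner ℝ (v i) (X ω) ^ 2} ≤ C * t ^ (-1 - η) := by
  classical
  -- The projection onto the span of the chosen vectors has rank at most `J.card` and preserves
  -- these inner products, so Bessel's inequality compares the sum with `‖P X‖ ^ 2`.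
  set K : Submodule ℝ (Euc n) := Submodule.span ℝ (J.image v : Set (Euc n)) with hK
  have hrank : (Module.finrank ℝ (LinearMap.range (K.starProjection : Euc n →ₗ[ℝ] Euc n)) : ℝ)
      ≤ J.card := by
    have h1 : LinearMap.range (K.starProjection : Euc n →ₗ[ℝ] Euc n) = K :=
      Submodule.range_starProjection K
    rw [h1]
    exact_mod_cast (finrank_span_finset_le_card (J.image v)).trans Finset.card_image_le
  refine le_trans (measureReal_mono ?_) (hSR K.starProjection isStarProjection_starProjection t
    (lt_of_le_of_lt (mul_le_mul_of_nonneg_left hrank hC.le) ht))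
  intro ω hω
  have hω' : t < ∑ i ∈ J, inner ℝ (v i) (X ω) ^ 2 := hω
  refine lt_of_lt_of_le hω' ?_
  have hb := hv.sum_inner_products_le (K.starProjection (X ω)) (s := J)
  refine le_trans (Finset.sum_le_sum fun i hi => le_of_eq ?_) hb
  have hmem : v i ∈ K := Submodule.subset_span (by simpa using ⟨i, hi, rfl⟩)
  have : inner ℝ (v i) (K.starProjection (X ω)) = inner ℝ (v i) (X ω) := by
    rw [← Submodule.inner_starProjection_left_eq_right, K.starProjection_eq_self_iff.2 hmem]
  rw [this, Real.norm_eq_abs, sq_abs]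

theorem exists_dyadic_level {b w : ℝ} (hb : 0 < b) (hw0 : 0 < w) (hwb : w ≤ b) :
    ∃ k : ℕ, b * (1 / 4) ^ (k + 1) ≤ w ∧ w ≤ b * (1 / 4) ^ k := by
  obtain ⟨k, h1, h2⟩ := exists_nat_pow_near_of_lt_one (div_pos hw0 hb) ((div_le_one hb).2 hwb)
    (by norm_num : (0 : ℝ) < 1 / 4) (by norm_num)
  exact ⟨k, by rw [lt_div_iff₀ hb] at h1; linarith, by rw [div_le_iff₀ hb] at h2; linarith⟩

/-- The weights are grouped by size up to factors of `4`, and strong regularity is applied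
to each group. -/
theorem StrongRegularity.measureReal_weighted_sum [IsFiniteMeasure μ] [Fintype ι]
    (hSR : StrongRegularity μ C η X) (hC : 0 < C) (hη : 0 < η) {v : ι → Euc n}
    (hv : Orthonormal ℝ v) {w : ι → ℝ} (hw : ∀ i, 0 < w i) {b : ℝ} (hb : 0 < b)
    (hwb : ∀ i, w i ≤ b) {t : ℝ} (ht : 0 < t) :
    μ.real {ω | 4 * C * ∑ i, w i + t < ∑ i, w i * inner ℝ (v i) (X ω) ^ 2} ≤
      2 * C * (2 * b / t) ^ (1 + η) := by
  classical
  choose k hk1 hk2 using fun i => exists_dyadic_level hb (hw i) (hwb i)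
  set J : ℕ → Finset ι := fun m => Finset.univ.filter fun i => k i = m with hJ
  set s : ℕ → ℝ := fun m => ∑ i ∈ J m, w i with hs
  set K : Finset ℕ := Finset.univ.image k with hK
  -- Group `m` has weights within a factor 4 of `b * (1 / 4) ^ m`. The term `4 C s m` lifts the
  -- threshold to `C` times the size of the group, and its share `t / 2 ^ (m + 1)` of the budget
  -- makes the inequality strict.
  set θ : ℕ → ℝ := fun m => (4 * C * s m + t * (1 / 2) ^ (m + 1)) / (b * (1 / 4) ^ m) with hθ
  have hb4 : ∀ m : ℕ, 0 < b * (1 / 4 : ℝ) ^ m := fun m => by positivity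
  have hs0 : ∀ m, 0 ≤ s m := fun m => Finset.sum_nonneg fun i _ => (hw i).le
  have hgeo : ∀ F : Finset ℕ, ∑ m ∈ F, (1 / 2 : ℝ) ^ m ≤ 2 := fun F => by
    have := summable_geometric_two.sum_le_tsum F fun i _ => by positivity
    rwa [tsum_geometric_two] at this
  have hfib : ∀ f : ι → ℝ, ∑ i, f i = ∑ m ∈ K, ∑ i ∈ J m, f i := fun f =>
    (Finset.sum_fiberwise_of_maps_to (fun i hi => Finset.mem_image_of_mem k hi) f).symm
  have hcard : ∀ m, C * (J m).card < θ m := by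
    intro m
    have h1 : ((J m).card : ℝ) * (b * (1 / 4) ^ (m + 1)) ≤ s m := by
      rw [← nsmul_eq_mul]
      refine Finset.card_nsmul_le_sum _ _ _ fun i hi => ?_
      have : k i = m := (Finset.mem_filter.1 hi).2
      rw [← this]
      exact hk1 i
    rw [hθ, lt_div_iff₀ (hb4 m)]
    have h2 : 0 < t * (1 / 2) ^ (m + 1) := by positivity
    have h3 : C * (J m).card * (b * (1 / 4) ^ m)
        = 4 * C * (((J m).card : ℝ) * (b * (1 / 4) ^ (m + 1))) := by
      rw [pow_succ]; ring
    have h4 := mul_le_mul_of_nonneg_left h1 (show 0 ≤ 4 * C by linarith)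
    linarith
  -- Weights decay like `4 ^ (-m)` but budget shares only like `2 ^ (-m)`, so thresholds grow like
  -- `2 ^ m` and the union bound is a geometric series.
  have hθlow : ∀ m, t / (2 * b) * 2 ^ m ≤ θ m := by
    intro m
    rw [hθ, le_div_iff₀ (hb4 m)]
    have h1 : t / (2 * b) * 2 ^ m * (b * (1 / 4) ^ m) = t * (1 / 2) ^ (m + 1) := by
      have : (1 / 4 : ℝ) ^ m = (1 / 2) ^ m * (1 / 2) ^ m := by rw [← mul_pow]; norm_num
      have h22 : (2 : ℝ) ^ m * (1 / 2) ^ m = 1 := by rw [← mul_pow]; norm_num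
      rw [this, pow_succ]
      calc _ = (t / 2) * (b / b) * (2 ^ m * (1 / 2) ^ m) * (1 / 2) ^ m := by field_simp
        _ = _ := by rw [h22, div_self hb.ne']; ring
    rw [h1]
    have := mul_nonneg (mul_nonneg (show (0 : ℝ) ≤ 4 by norm_num) hC.le) (hs0 m)
    linarith
  have hprob : ∀ m, μ.real {ω | θ m < ∑ i ∈ J m, inner ℝ (v i) (X ω) ^ 2} ≤
      C * (2 * b / t) ^ (1 + η) * (1 / 2) ^ m := by
    intro m
    refine (hSR.measureReal_sum_inner_sq hC hv (J m) (hcard m)).trans ?_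
    rw [mul_assoc]
    refine mul_le_mul_of_nonneg_left ?_ hC.le
    have hpos : 0 < t / (2 * b) * 2 ^ m := by positivity
    calc θ m ^ (-1 - η) ≤ (t / (2 * b) * 2 ^ m) ^ (-1 - η) :=
          Real.rpow_le_rpow_of_nonpos hpos (hθlow m) (by linarith)
      _ = (2 * b / t) ^ (1 + η) * ((1 / 2) ^ m) ^ (1 + η) := by
          rw [show -1 - η = -(1 + η) by ring, Real.rpow_neg hpos.le, ← Real.inv_rpow hpos.le,
            ← Real.mul_rpow (by positivity) (by positivity)]
          congr 1
          rw [mul_inv, inv_div, one_div, inv_pow]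
      _ ≤ (2 * b / t) ^ (1 + η) * (1 / 2) ^ m := by
          refine mul_le_mul_of_nonneg_left ?_ (by positivity)
          exact (Real.rpow_le_rpow_of_exponent_ge (by positivity)
            (pow_le_one₀ (by norm_num) (by norm_num)) (by linarith : (1 : ℝ) ≤ 1 + η)).trans_eq
            (Real.rpow_one _)
  have hsub : {ω | 4 * C * ∑ i, w i + t < ∑ i, w i * inner ℝ (v i) (X ω) ^ 2} ⊆
      ⋃ m ∈ K, {ω | θ m < ∑ i ∈ J m, inner ℝ (v i) (X ω) ^ 2} := by
    intro ω hω
    by_contra hcon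
    simp only [Set.mem_iUnion, Set.mem_ofPred_eq, not_exists, not_lt] at hcon
    refine absurd (show 4 * C * ∑ i, w i + t < ∑ i, w i * inner ℝ (v i) (X ω) ^ 2 from hω)
      (not_lt.2 ?_)
    rw [hfib (fun i => w i * inner ℝ (v i) (X ω) ^ 2), hfib w, Finset.mul_sum]
    have h1 : ∀ m ∈ K, ∑ i ∈ J m, w i * inner ℝ (v i) (X ω) ^ 2 ≤
        4 * C * s m + t / 2 * (1 / 2) ^ m := by
      intro m hm
      calc ∑ i ∈ J m, w i * inner ℝ (v i) (X ω) ^ 2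
          ≤ ∑ i ∈ J m, b * (1 / 4) ^ m * inner ℝ (v i) (X ω) ^ 2 := by
            refine Finset.sum_le_sum fun i hi => ?_
            have : k i = m := (Finset.mem_filter.1 hi).2
            refine mul_le_mul_of_nonneg_right ?_ (sq_nonneg _)
            rw [← this]
            exact hk2 i
        _ = (∑ i ∈ J m, inner ℝ (v i) (X ω) ^ 2) * (b * (1 / 4) ^ m) := by
            rw [← Finset.mul_sum, mul_comm]
        _ ≤ θ m * (b * (1 / 4) ^ m) := by
            have := hb4 m
            have := hcon m hm
            gcongr
        _ = 4 * C * s m + t / 2 * (1 / 2) ^ m := by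
            rw [hθ, div_mul_cancel₀ _ (hb4 m).ne', pow_succ]; ring
    refine (Finset.sum_le_sum h1).trans ?_
    rw [Finset.sum_add_distrib, ← Finset.mul_sum, ← Finset.mul_sum]
    have := hgeo K
    have : t / 2 * ∑ m ∈ K, (1 / 2 : ℝ) ^ m ≤ t := by nlinarith
    linarith
  calc _ ≤ μ.real (⋃ m ∈ K, {ω | θ m < ∑ i ∈ J m, inner ℝ (v i) (X ω) ^ 2}) :=
        measureReal_mono hsub (measure_ne_top μ _)
    _ ≤ ∑ m ∈ K, μ.real {ω | θ m < ∑ i ∈ J m, inner ℝ (v i) (X ω) ^ 2} :=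
        measureReal_biUnion_finset_le _ _
    _ ≤ ∑ m ∈ K, C * (2 * b / t) ^ (1 + η) * (1 / 2) ^ m := Finset.sum_le_sum fun m _ => hprob m
    _ ≤ C * (2 * b / t) ^ (1 + η) * 2 := by
        rw [← Finset.mul_sum]
        exact mul_le_mul_of_nonneg_left (hgeo K) (by positivity)
    _ = _ := by ring

theorem StrongRegularity.measureReal_weighted_sum_of_le [IsFiniteMeasure μ] [Fintype ι]
    (hSR : StrongRegularity μ C η X) (hC : 0 < C) (hη : 0 < η) {v : ι → Euc n}
    (hv : Orthonormal ℝ v) {w : ι → ℝ} (hw : ∀ i, 0 < w i) {b s : ℝ} (hb : 0 < b)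
    (hwb : ∀ i, w i ≤ b) (hws : ∑ i, w i ≤ s) {t : ℝ} (ht : 0 < t) (hts : 8 * C * s ≤ t) :
    μ.real {ω | t < ∑ i, w i * inner ℝ (v i) (X ω) ^ 2} ≤ 2 * C * (4 * b / t) ^ (1 + η) := by
  have h1 := hSR.measureReal_weighted_sum hC hη hv hw hb hwb (half_pos ht)
  rw [show 2 * b / (t / 2) = 4 * b / t by field_simp; ring] at h1
  refine le_trans (measureReal_mono (fun ω hω => ?_) (measure_ne_top μ _)) h1
  have hω' : t < ∑ i, w i * inner ℝ (v i) (X ω) ^ 2 := hω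
  refine lt_of_le_of_lt ?_ hω'
  have := mul_le_mul_of_nonneg_left hws (show 0 ≤ 4 * C by linarith)
  linarith

theorem IsIsotropic.integral_inner_sq (hX : IsIsotropic μ X) (v : Euc n) :
    Integrable (fun ω => inner ℝ v (X ω) ^ 2) μ ∧ ∫ ω, inner ℝ v (X ω) ^ 2 ∂μ = ‖v‖ ^ 2 := by
  have e : (fun ω => inner ℝ v (X ω) ^ 2) =
      fun ω => ∑ j, ∑ k, v j * v k * outer (X ω) j k := by
    ext ω
    rw [PiLp.inner_apply, sq, Finset.sum_mul_sum]
    refine Finset.sum_congr rfl fun j _ => Finset.sum_congr rfl fun k _ => ?_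
    simp [outer]
    ring
  have hi : ∀ j k, Integrable (fun ω => v j * v k * outer (X ω) j k) μ := fun j k =>
    (hX.1 j k).const_mul _
  rw [e]
  refine ⟨integrable_finsetSum _ fun j _ => integrable_finsetSum _ fun k _ => hi j k, ?_⟩
  rw [integral_finsetSum _ fun j _ => integrable_finsetSum _ fun k _ => hi j k,
    EuclideanSpace.real_norm_sq_eq]
  refine Finset.sum_congr rfl fun j _ => ?_
  rw [integral_finsetSum _ fun k _ => hi j k]
  have h1 : ∀ k, ∫ ω, outer (X ω) j k ∂μ = (1 : Matrix (Fin n) (Fin n) ℝ) j k := fun k =>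
    congrFun (congrFun hX.2 j) k
  simp only [integral_const_mul, h1, Matrix.one_apply]
  simp [sq]

end Tail

end CovEst

/-! ### One random step in expectation -/

namespace CovEst

theorem continuous_softEdge_comp {n : ℕ} [NeZero n] {φ : ℝ} (hφ : 0 < φ) {S : Type*}
    [TopologicalSpace S] {f : S → Matrix (Fin n) (Fin n) ℝ}
    (hf : ∀ j k, Continuous fun y => f y j k) (hH : ∀ y, (f y).IsHermitian) :
    Continuous fun y => softEdge φ (f y) := by
  rw [continuous_iff_continuousAt]
  intro y₀
  rw [ContinuousAt, tendsto_iff_dist_tendsto_zero]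
  have hlim : Filter.Tendsto (fun y => ∑ j, ∑ k, |f y j k - f y₀ j k|) (nhds y₀) (nhds 0) := by
    have hc : Continuous fun y => ∑ j, ∑ k, |f y j k - f y₀ j k| := by fun_prop
    simpa using hc.tendsto y₀
  refine squeeze_zero (fun _ => dist_nonneg) (fun y => ?_) hlim
  rw [Real.dist_eq]
  exact abs_softEdge_sub_le hφ (hH y) (hH y₀)

theorem isHermitian_add_smul_outer {n : ℕ} {A : Matrix (Fin n) (Fin n) ℝ} (hA : A.IsHermitian)
    (s : ℝ) (x : Euc n) : (A + s • outer x).IsHermitian :=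
  hA.add ((outer_isHermitian x).smul (IsSelfAdjoint.all _))

theorem abs_softEdge_add_outer_sub_le {n : ℕ} [NeZero n] {φ : ℝ} (hφ : 0 < φ)
    {A : Matrix (Fin n) (Fin n) ℝ} (hA : A.IsHermitian) {s : ℝ} (hs : s = 1 ∨ s = -1)
    (x : Euc n) : |softEdge φ (A + s • outer x) - softEdge φ A| ≤ ‖x‖ ^ 2 := by
  have hB := isHermitian_add_smul_outer hA s x
  have h1 := posSemidef_outer x
  have h2 := posSemidef_norm_sq_smul_one_sub_outer x
  rw [abs_le]
  rcases hs with rfl | rfl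
  · constructor
    · have := softEdge_le_add (A := A) (c := 0) hφ hB (by simpa using h1)
      nlinarith [sq_nonneg ‖x‖]
    · have := softEdge_le_add (A := A + (1 : ℝ) • outer x) (c := ‖x‖ ^ 2) hφ hA (by
        convert h2 using 1
        rw [one_smul]; abel)
      linarith
  · constructor
    · have := softEdge_le_add (A := A) (c := ‖x‖ ^ 2) hφ hB (by
        convert h2 using 1
        rw [neg_one_smul]; abel)
      linarith
    · have := softEdge_sub_outer_le hφ hA x
      nlinarith [sq_nonneg ‖x‖]

section Step

variable {Ω : Type*} [MeasurableSpace Ω] {μ : Measure Ω}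

/-- The accounting common to both signs: off `B` the bound is linear in `Q`, which has mean one; on
`B` one pays `T`, plus the excess of `G` over `T`. -/
theorem integral_le_of_le_truncation [IsProbabilityMeasure μ] {F Q G : Ω → ℝ} {B : Set Ω}
    {D T η u a : ℝ} (hF : Integrable F μ) (hQ : Integrable Q μ) (hQ1 : ∫ ω, Q ω ∂μ = 1)
    (hB : MeasurableSet B) (hG : Measurable G) (hD : 0 ≤ D) (hT : 0 < T) (hη : 0 < η)
    (hBp : μ.real B ≤ D * T ^ (-1 - η))
    (hGt : ∀ t, T ≤ t → μ.real {ω | t < G ω} ≤ D * t ^ (-1 - η))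
    (hle : ∀ ω, F ω ≤ u + a * Q ω + B.indicator (fun _ => T) ω + max (G ω - T) 0) :
    ∫ ω, F ω ∂μ ≤ u + a + D * (1 + 1 / η) * T ^ (-η) := by
  obtain ⟨hi, hv⟩ := integral_excess_le hG hD hT hη hGt
  have hind : Integrable (B.indicator fun _ => T) μ := (integrable_const T).indicator hB
  have h1 : Integrable (fun ω => u + a * Q ω) μ := (integrable_const u).add (hQ.const_mul a)
  have h2 : Integrable (fun ω => u + a * Q ω + B.indicator (fun _ => T) ω) μ := h1.add hind
  have hm := integral_mono hF (h2.add hi) hle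
  have e : ∫ ω, (u + a * Q ω + B.indicator (fun _ => T) ω + max (G ω - T) 0) ∂μ =
      u + a + T * μ.real B + ∫ ω, max (G ω - T) 0 ∂μ := by
    rw [integral_add h2 hi, integral_add h1 hind, integral_add (integrable_const u)
      (hQ.const_mul a), integral_const_mul, hQ1, integral_indicator_const _ hB]
    simp [mul_comm]
  have hTB : T * μ.real B ≤ D * T ^ (-η) := by
    calc T * μ.real B ≤ T * (D * T ^ (-1 - η)) := mul_le_mul_of_nonneg_left hBp hT.le
      _ = D * (T ^ (1 : ℝ) * T ^ (-1 - η)) := by rw [Real.rpow_one]; ring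
      _ = D * T ^ (-η) := by rw [← Real.rpow_add hT]; ring_nf
  have e2 : D * (1 + 1 / η) * T ^ (-η) = D * T ^ (-η) + D * T ^ (-η) / η := by ring
  calc ∫ ω, F ω ∂μ ≤ _ := hm
    _ = u + a + T * μ.real B + ∫ ω, max (G ω - T) 0 ∂μ := e
    _ ≤ _ := by rw [e2]; linarith

variable {n : ℕ} {X : Ω → Euc n} {C η : ℝ} {ι : Type*} [Fintype ι]

theorem IsIsotropic.integrable_norm_sq (hX : IsIsotropic μ X) :
    Integrable (fun ω => ‖X ω‖ ^ 2) μ := by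
  have e : (fun ω => ‖X ω‖ ^ 2) = fun ω => ∑ j, outer (X ω) j j := by
    ext ω
    rw [EuclideanSpace.real_norm_sq_eq]
    simp [outer, sq]
  rw [e]
  exact integrable_finsetSum _ fun j _ => hX.1 j j

theorem normalizedForm_eq_sum (h y : ι → ℝ) :
    normalizedForm h y = ∑ i, (1 / h i ^ 2 / ∑ j, 1 / h j ^ 2) * y i ^ 2 := by
  rw [normalizedForm, Finset.sum_div]
  exact Finset.sum_congr rfl fun i _ => by ring

theorem sum_normalized_weights [Nonempty ι] {h : ι → ℝ} (hh : ∀ i, 0 < h i) :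
    ∑ i, 1 / h i ^ 2 / ∑ j, 1 / h j ^ 2 = 1 := by
  rw [← Finset.sum_div, div_self (sum_one_div_sq_pos hh).ne']

theorem StrongRegularity.measureReal_normalizedForm [IsFiniteMeasure μ] [Nonempty ι]
    (hSR : StrongRegularity μ C η X) (hC : 0 < C) (hη : 0 < η) {v : ι → Euc n}
    (hv : Orthonormal ℝ v) {h : ι → ℝ} (hh : ∀ i, 0 < h i) {t : ℝ} (ht : 8 * C ≤ t) :
    μ.real {ω | t < normalizedForm h fun i => inner ℝ (v i) (X ω)} ≤
      2 * C * (4 / t) ^ (1 + η) := by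
  have hw : ∀ i, 0 < 1 / h i ^ 2 / ∑ j, 1 / h j ^ 2 := fun i => by
    have := sum_one_div_sq_pos hh
    have := hh i
    positivity
  have h1 := sum_normalized_weights hh
  have := hSR.measureReal_weighted_sum_of_le hC hη hv hw one_pos
    (fun i => (Finset.single_le_sum (f := fun i => 1 / h i ^ 2 / ∑ j, 1 / h j ^ 2)
      (fun j _ => (hw j).le) (Finset.mem_univ i)).trans h1.le) h1.le (t := t) (by linarith)
    (by linarith)
  simpa only [normalizedForm_eq_sum, mul_one] using this

theorem IsIsotropic.integral_normalizedForm [Nonempty ι] (hX : IsIsotropic μ X)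
    {v : ι → Euc n} (hv : Orthonormal ℝ v) {h : ι → ℝ} (hh : ∀ i, 0 < h i) :
    Integrable (fun ω => normalizedForm h fun i => inner ℝ (v i) (X ω)) μ ∧
      ∫ ω, normalizedForm h (fun i => inner ℝ (v i) (X ω)) ∂μ = 1 := by
  simp only [normalizedForm_eq_sum]
  have hi := fun i => ((hX.integral_inner_sq (v i)).1).const_mul (1 / h i ^ 2 / ∑ j, 1 / h j ^ 2)
  refine ⟨integrable_finsetSum _ fun i _ => hi i, ?_⟩
  rw [integral_finsetSum _ fun i _ => hi i]
  refine (Finset.sum_congr rfl fun i _ => ?_).trans (sum_normalized_weights hh)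
  rw [integral_const_mul, (hX.integral_inner_sq (v i)).2, hv.1 i]
  simp

theorem div_rpow_eq {c t p : ℝ} (hc : 0 ≤ c) (ht : 0 < t) :
    (c / t) ^ (1 + p) = c ^ (1 + p) * t ^ (-1 - p) := by
  rw [Real.div_rpow hc ht.le, div_eq_mul_inv, ← Real.rpow_neg ht.le]
  ring_nf

variable {φ e T : ℝ} {A : Matrix (Fin n) (Fin n) ℝ}

/-- One step of the barrier argument, in expectation. -/
theorem integral_softEdge_add_outer_le [NeZero n] [IsProbabilityMeasure μ] (hXm : Measurable X)
    (hX : IsIsotropic μ X) (hSR : StrongRegularity μ C η X) (hC : 0 < C) (hη : 0 < η)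
    (he0 : 0 < e) (he : e ≤ 1 / 20) (hT : 16 * C ≤ T) (hφT : φ = e / T)
    (herr : 4 * C * 8 ^ (1 + η) * (1 + 1 / η) * T ^ (-η) ≤ e) (hA : A.IsHermitian)
    {s : ℝ} (hs : s = 1 ∨ s = -1) :
    Integrable (fun ω => softEdge φ (A + s • outer (X ω))) μ ∧
      ∫ ω, softEdge φ (A + s • outer (X ω)) ∂μ ≤ softEdge φ A + s + 5 * e := by
  have hT0 : 0 < T := by linarith
  have hφ : 0 < φ := by rw [hφT]; positivity
  have hTφ : T * φ = e := by rw [hφT]; field_simp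
  have hcont : Continuous fun x : Euc n => softEdge φ (A + s • outer x) := by
    refine continuous_softEdge_comp hφ (fun j k => ?_)
      (isHermitian_add_smul_outer hA s)
    simp only [Matrix.add_apply, Matrix.smul_apply, outer, Matrix.of_apply]
    fun_prop
  have hFm : Measurable fun ω => softEdge φ (A + s • outer (X ω)) := hcont.measurable.comp hXm
  have hFi : Integrable (fun ω => softEdge φ (A + s • outer (X ω))) μ := by
    have h1 : Integrable (fun ω => softEdge φ (A + s • outer (X ω)) - softEdge φ A) μ :=
      hX.integrable_norm_sq.mono' (hFm.sub_const _).aestronglyMeasurable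
        (ae_of_all _ fun ω => abs_softEdge_add_outer_sub_le hφ hA hs (X ω))
    refine (h1.add (integrable_const (softEdge φ A))).congr (ae_of_all _ fun ω => ?_)
    simp
  refine ⟨hFi, ?_⟩
  rw [add_assoc, ← sub_le_iff_le_add]
  -- The estimate is proved from an arbitrary feasible `u`, so attainment of the infimum is not
  -- needed.
  refine le_csInf (exists_feasible hφ hA) fun u hu => ?_
  have hu : Feasible φ A u := hu
  rw [sub_le_iff_le_add]
  -- The largest tail needed below: two events, each of probability at most `2 C (8 / t) ^ (1 + η)`.
  set D := 4 * C * 8 ^ (1 + η) with hDd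
  have hD0 : 0 ≤ D := by positivity
  set h : Fin n → ℝ := fun i => u - hA.eigenvalues i with hh
  set y : Ω → Fin n → ℝ := fun ω i => inner ℝ (hA.eigenvectorBasis i) (X ω) with hy
  have hv := hA.eigenvectorBasis.orthonormal
  have hpos : ∀ i, 0 < h i := sub_eigenvalues_pos hA hu
  have hsum : ∑ i, 1 / h i ≤ φ := sum_one_div_le hA hu
  have hym : ∀ i, Measurable fun ω => y ω i := fun i =>
    (by fun_prop : Continuous fun x : Euc n =>
      inner ℝ (hA.eigenvectorBasis i) x).measurable.comp hXm
  have hQm : Measurable fun ω => normalizedForm h (y ω) := by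
    unfold normalizedForm
    fun_prop
  have hqm : Measurable fun ω => ∑ i, y ω i ^ 2 / h i := by fun_prop
  obtain ⟨hQi, hQ1⟩ := hX.integral_normalizedForm hv hpos
  set B : Set Ω := {ω | e < ∑ i, y ω i ^ 2 / h i} ∪ {ω | T < normalizedForm h (y ω)} with hBd
  have hBm : MeasurableSet B :=
    (measurableSet_lt measurable_const hqm).union (measurableSet_lt measurable_const hQm)
  have h48 : ∀ {t : ℝ}, 0 < t → 4 * C * (4 / t) ^ (1 + η) ≤ D * t ^ (-1 - η) := by
    intro t ht
    rw [div_rpow_eq (by norm_num) ht, hDd, mul_assoc (4 * C)]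
    have := Real.rpow_le_rpow (by norm_num) (by norm_num : (4 : ℝ) ≤ 8)
      (by linarith : 0 ≤ 1 + η)
    gcongr
  have hNFt : ∀ t, T ≤ t → μ.real {ω | t < normalizedForm h (y ω)} ≤
      2 * C * (4 / t) ^ (1 + η) := fun t ht =>
    hSR.measureReal_normalizedForm hC hη hv hpos (by linarith)
  have hBp : μ.real B ≤ D * T ^ (-1 - η) := by
    have h1 : μ.real {ω | e < ∑ i, y ω i ^ 2 / h i} ≤ 2 * C * (4 * φ / e) ^ (1 + η) := by
      have := hSR.measureReal_weighted_sum_of_le hC hη hv (fun i => one_div_pos.2 (hpos i)) hφ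
        (fun i => (Finset.single_le_sum (f := fun i => 1 / h i)
          (fun j _ => (one_div_pos.2 (hpos j)).le) (Finset.mem_univ i)).trans hsum) hsum he0
        (by nlinarith)
      simpa only [hy, one_div_mul_eq_div] using this
    have h2 := hNFt T le_rfl
    rw [show 4 * φ / e = 4 / T by rw [hφT]; field_simp] at h1
    have h3 := measureReal_union_le (μ := μ) {ω | e < ∑ i, y ω i ^ 2 / h i}
      {ω | T < normalizedForm h (y ω)}
    have h4 := h48 hT0
    linarith
  have hoff : ∀ ω, ω ∉ B → ∑ i, y ω i ^ 2 / h i ≤ e ∧ normalizedForm h (y ω) * φ ≤ e := by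
    intro ω hω
    simp only [hBd, Set.mem_union, Set.mem_ofPred_eq, not_or, not_lt] at hω
    exact ⟨hω.1, by nlinarith [hω.2]⟩
  rcases hs with rfl | rfl
  · have hGt : ∀ t, T ≤ t → μ.real {ω | t < softEdge φ (A + (1 : ℝ) • outer (X ω)) - u} ≤
        D * t ^ (-1 - η) := by
      intro t ht
      have ht0 : 0 < t := by linarith
      have hpos' : ∀ i, 0 < h i + t := fun i => add_pos (hpos i) ht0
      have h1 : μ.real {ω | 1 / 2 < ∑ i, y ω i ^ 2 / (h i + t)} ≤
          2 * C * (4 * (1 / t) / (1 / 2)) ^ (1 + η) := by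
        have := hSR.measureReal_weighted_sum_of_le hC hη hv
          (fun i => one_div_pos.2 (hpos' i)) (one_div_pos.2 ht0)
          (fun i => one_div_le_one_div_of_le ht0 (by have := hpos i; linarith))
          (s := φ) (le_trans (Finset.sum_le_sum fun i _ =>
            one_div_le_one_div_of_le (hpos i) (by linarith)) hsum) (t := 1 / 2) (by norm_num)
          (by nlinarith)
        simpa only [hy, one_div_mul_eq_div] using this
      -- The condition `8 C ≤ t / 2` is the reason for assuming `16 C ≤ T`.
      have h2 := hSR.measureReal_normalizedForm hC hη hv hpos' (t := t / 2) (by linarith)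
      rw [show 4 * (1 / t) / (1 / 2) = 8 / t by field_simp; norm_num] at h1
      rw [show 4 / (t / 2) = 8 / t by field_simp; norm_num] at h2
      have hsub : {ω | t < softEdge φ (A + (1 : ℝ) • outer (X ω)) - u} ⊆
          {ω | 1 / 2 < ∑ i, y ω i ^ 2 / (h i + t)} ∪
            {ω | t / 2 < normalizedForm (fun i => h i + t) (y ω)} := by
        intro ω hω
        by_contra hcon
        simp only [Set.mem_union, Set.mem_ofPred_eq, not_or, not_lt] at hcon hω
        have := softEdge_add_outer_le_of_form_le hA hu (X ω) ht0 (h := h) (y := y ω) rfl rfl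
          hcon.1 hcon.2
        rw [one_smul] at hω
        linarith
      have h3 := measureReal_mono hsub (measure_ne_top μ _)
      have h4 := measureReal_union_le (μ := μ) {ω | 1 / 2 < ∑ i, y ω i ^ 2 / (h i + t)}
            {ω | t / 2 < normalizedForm (fun i => h i + t) (y ω)}
      rw [div_rpow_eq (by norm_num) ht0] at h1 h2
      calc _ ≤ _ := h3
        _ ≤ _ := h4
        _ ≤ 2 * C * (8 ^ (1 + η) * t ^ (-1 - η)) + 2 * C * (8 ^ (1 + η) * t ^ (-1 - η)) :=
          add_le_add h1 h2
        _ = _ := by rw [hDd]; ring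
    have := integral_le_of_le_truncation (u := u) (a := 1 + 4 * e) hFi hQi hQ1 hBm
      (hFm.sub_const u) hD0 hT0 hη hBp hGt (by
        intro ω
        by_cases hω : ω ∈ B
        · rw [Set.indicator_of_mem hω]
          have h1 := le_max_left (softEdge φ (A + (1 : ℝ) • outer (X ω)) - u - T) 0
          have h2 : 0 ≤ normalizedForm h (y ω) := normalizedForm_nonneg
          have h3 : 0 ≤ (1 + 4 * e) * normalizedForm h (y ω) := by positivity
          linarith
        · rw [Set.indicator_of_notMem hω]
          have h1 := le_max_right (softEdge φ (A + (1 : ℝ) • outer (X ω)) - u - T) 0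
          have h2 := softEdge_add_outer_le_normalizedForm hA hu (X ω) he0 he (h := h)
            (y := y ω) rfl rfl (hoff ω hω).1 (hoff ω hω).2
          rw [one_smul] at h1 ⊢
          linarith)
    linarith
  · have hGt : ∀ t, T ≤ t → μ.real {ω | t < normalizedForm h (y ω)} ≤ D * t ^ (-1 - η) := by
      intro t ht
      have ht0 : 0 < t := by linarith
      have h1 := hNFt t ht
      have h2 := h48 ht0
      have h3 : 0 ≤ 2 * C * (4 / t) ^ (1 + η) := by positivity
      linarith
    have := integral_le_of_le_truncation (u := u) (a := -(1 - 3 * e)) hFi hQi hQ1 hBm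
      hQm hD0 hT0 hη hBp hGt (by
        intro ω
        by_cases hω : ω ∈ B
        · rw [Set.indicator_of_mem hω]
          have h1 := le_max_left (normalizedForm h (y ω) - T) 0
          have h2 : 0 ≤ normalizedForm h (y ω) := normalizedForm_nonneg
          have h3 : 0 ≤ 3 * e * normalizedForm h (y ω) := by positivity
          -- On `B` only monotonicity is available; the credit `(1 - 3 e) Q` in the target must be
          -- repaid there, which is why `Q` itself serves as `G`.
          have h4 := softEdge_sub_outer_le hφ hA (X ω)
          have h5 := softEdge_le hu
          change _ ≤ u + -(1 - 3 * e) * normalizedForm h (y ω) + T +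
            max (normalizedForm h (y ω) - T) 0
          linarith
        · rw [Set.indicator_of_notMem hω]
          have h1 := le_max_right (normalizedForm h (y ω) - T) 0
          have h2 := softEdge_sub_outer_le_normalizedForm hA hu (X ω) he0 he (h := h)
            (y := y ω) rfl rfl (hoff ω hω).1 (hoff ω hω).2
          change _ ≤ u + -(1 - 3 * e) * normalizedForm h (y ω) + 0 +
            max (normalizedForm h (y ω) - T) 0
          linarith)
    linarith

end Step

end CovEst

/-! ### Iteration over the independent vectors -/

namespace CovEst

section Iterate

variable {Ω : Type*} [MeasurableSpace Ω] {μ : Measure Ω} {n N : ℕ} {X : Fin N → Ω → Euc n}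
  {C η φ e T s : ℝ}

theorem isHermitian_sum_smul_outer {ι : Type*} (t : Finset ι) (s : ℝ) (x : ι → Euc n) :
    (∑ i ∈ t, s • outer (x i)).IsHermitian := by
  classical
  induction t using Finset.induction_on with
  | empty => simp
  | insert a t ha ih =>
    rw [Finset.sum_insert ha, add_comm]
    exact isHermitian_add_smul_outer ih s _

/-- The new vector is independent of the partial sum, so the one-step bound holds with the partial
sum frozen, and Fubini integrates it. The induction starts from the edge `n / φ` of the zero matrix.
-/
theorem integral_softEdge_sum_le [NeZero n] [IsProbabilityMeasure μ]
    (hXm : ∀ i, Measurable (X i)) (hind : iIndepFun X μ) (hX : ∀ i, IsIsotropic μ (X i))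
    (hSR : ∀ i, StrongRegularity μ C η (X i)) (hC : 0 < C) (hη : 0 < η)
    (he0 : 0 < e) (he : e ≤ 1 / 20) (hT : 16 * C ≤ T) (hφT : φ = e / T)
    (herr : 4 * C * 8 ^ (1 + η) * (1 + 1 / η) * T ^ (-η) ≤ e)
    (hs : s = 1 ∨ s = -1) (t : Finset (Fin N)) :
    Integrable (fun ω => softEdge φ (∑ i ∈ t, s • outer (X i ω))) μ ∧
      ∫ ω, softEdge φ (∑ i ∈ t, s • outer (X i ω)) ∂μ ≤ n / φ + t.card * (s + 5 * e) := by
  have hT0 : 0 < T := by linarith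
  have hφ : 0 < φ := by rw [hφT]; positivity
  induction t using Finset.induction_on with
  | empty =>
    simp only [Finset.sum_empty, integral_const, Finset.card_empty]
    refine ⟨integrable_const _, ?_⟩
    simpa using softEdge_zero_le (n := n) hφ
  | insert a t ha ih =>
    set Y : Ω → t → Euc n := fun ω i => X i ω with hY
    have hYm : Measurable Y := measurable_pi_lambda _ fun i => hXm i
    have hYX : IndepFun Y (X a) μ := by
      have h1 := hind.indepFun_finset t {a} (by simpa using ha) hXm
      exact h1.comp measurable_id
        (measurable_pi_apply (⟨a, Finset.mem_singleton_self a⟩ : ({a} : Finset (Fin N))))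
    set H : (t → Euc n) → Matrix (Fin n) (Fin n) ℝ := fun g => ∑ i, s • outer (g i) with hH
    have hHh : ∀ g, (H g).IsHermitian := fun g => isHermitian_sum_smul_outer _ s g
    have hHc : ∀ j k, Continuous fun g => H g j k := by
      intro j k
      simp only [hH, Matrix.sum_apply, Matrix.smul_apply, outer, Matrix.of_apply]
      fun_prop
    have hsum : ∀ ω, ∑ i ∈ t, s • outer (X i ω) = H (Y ω) := fun ω =>
      (Finset.sum_coe_sort t fun i => s • outer (X i ω)).symm
    have hsum' : ∀ ω, ∑ i ∈ insert a t, s • outer (X i ω) = H (Y ω) + s • outer (X a ω) :=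
      fun ω => by rw [Finset.sum_insert ha, hsum, add_comm]
    set F : (t → Euc n) × Euc n → ℝ := fun p => softEdge φ (H p.1 + s • outer p.2) with hF
    have hFc : Continuous F := by
      refine continuous_softEdge_comp hφ (fun j k => ?_)
        fun p => isHermitian_add_smul_outer (hHh _) s _
      have := (hHc j k).comp (continuous_fst (X := t → Euc n) (Y := Euc n))
      simp only [Matrix.add_apply, Matrix.smul_apply, outer, Matrix.of_apply]
      refine this.add ?_
      fun_prop
    have hGc : Continuous fun g => softEdge φ (H g) := continuous_softEdge_comp hφ hHc hHh
    simp only [hsum] at ih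
    obtain ⟨ihi, ihv⟩ := ih
    -- Fubini needs joint integrability first; it follows since the increment is at most `‖X a‖ ^ 2`
    -- in absolute value.
    have hFi : Integrable (fun ω => F (Y ω, X a ω)) μ := by
      have h1 : Integrable (fun ω => F (Y ω, X a ω) - softEdge φ (H (Y ω))) μ :=
        (hX a).integrable_norm_sq.mono'
          ((hFc.measurable.comp (hYm.prodMk (hXm a))).sub
            (hGc.measurable.comp hYm)).aestronglyMeasurable
          (ae_of_all _ fun ω => abs_softEdge_add_outer_sub_le hφ (hHh _) hs (X a ω))
      refine (h1.add ihi).congr (ae_of_all _ fun ω => ?_)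
      simp
    simp only [hsum']
    refine ⟨hFi, ?_⟩
    have hpm : AEMeasurable (fun ω => (Y ω, X a ω)) μ := (hYm.prodMk (hXm a)).aemeasurable
    have hlaw : μ.map (fun ω => (Y ω, X a ω)) = (μ.map Y).prod (μ.map (X a)) :=
      (indepFun_iff_map_prod_eq_prod_map_map hYm.aemeasurable (hXm a).aemeasurable).1 hYX
    have : IsProbabilityMeasure (μ.map Y) := Measure.isProbabilityMeasure_map hYm.aemeasurable
    have : IsProbabilityMeasure (μ.map (X a)) :=
      Measure.isProbabilityMeasure_map (hXm a).aemeasurable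
    have hFp : Integrable F ((μ.map Y).prod (μ.map (X a))) := by
      rw [← hlaw]
      exact (integrable_map_measure hFc.measurable.aestronglyMeasurable hpm).2 hFi
    have hGi : Integrable (fun g => softEdge φ (H g)) (μ.map Y) :=
      (integrable_map_measure hGc.measurable.aestronglyMeasurable hYm.aemeasurable).2 ihi
    have hinner : ∀ g, ∫ x, F (g, x) ∂(μ.map (X a)) ≤ softEdge φ (H g) + (s + 5 * e) := by
      intro g
      have hc : Continuous fun x => F (g, x) := hFc.comp (Continuous.prodMk_right g)
      rw [integral_map (hXm a).aemeasurable hc.measurable.aestronglyMeasurable, ← add_assoc]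
      exact (integral_softEdge_add_outer_le (hXm a) (hX a) (hSR a) hC hη he0 he hT hφT herr
        (hHh g) hs).2
    calc ∫ ω, F (Y ω, X a ω) ∂μ = ∫ p, F p ∂((μ.map Y).prod (μ.map (X a))) := by
          rw [← hlaw, integral_map hpm hFc.measurable.aestronglyMeasurable]
      _ = ∫ g, ∫ x, F (g, x) ∂(μ.map (X a)) ∂(μ.map Y) := integral_prod _ hFp
      _ ≤ ∫ g, (softEdge φ (H g) + (s + 5 * e)) ∂(μ.map Y) :=
          integral_mono hFp.integral_prod_left (hGi.add (integrable_const _)) hinner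
      _ = ∫ ω, softEdge φ (H (Y ω)) ∂μ + (s + 5 * e) := by
          rw [integral_add hGi (integrable_const _), integral_map hYm.aemeasurable
            hGc.measurable.aestronglyMeasurable]
          simp
      _ ≤ n / φ + (insert a t).card * (s + 5 * e) := by
          rw [Finset.card_insert_of_notMem ha]
          push_cast
          linarith

end Iterate

end CovEst

/-! ### Spectral norm from two-sided bounds; mean deviation of one coordinate -/

namespace CovEst

theorem specNorm_le_of_le {n : ℕ} {M : Matrix (Fin n) (Fin n) ℝ} {b : ℝ} (hb : 0 ≤ b)
    (h1 : (b • (1 : Matrix (Fin n) (Fin n) ℝ) - M).PosSemidef)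
    (h2 : (b • (1 : Matrix (Fin n) (Fin n) ℝ) + M).PosSemidef) : specNorm M ≤ b := by
  have hM : M.IsHermitian := by
    have := (Matrix.isHermitian_one.smul (IsSelfAdjoint.all b)).sub h1.isHermitian
    simpa using this
  have hsym : (Matrix.toEuclideanCLM (n := Fin n) (𝕜 := ℝ) M : Euc n →ₗ[ℝ] Euc n).IsSymmetric := by
    rw [Matrix.coe_toEuclideanCLM_eq_toEuclideanLin]
    exact Matrix.isSymmetric_toEuclideanLin_iff.2 hM
  rw [specNorm, ContinuousLinearMap.norm_eq_iSup_rayleighQuotient _ hsym]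
  refine Real.iSup_le (fun x => ?_) hb
  rw [ContinuousLinearMap.rayleighQuotient, ContinuousLinearMap.reApplyInnerSelf_apply,
    abs_div, abs_of_nonneg (sq_nonneg ‖x‖)]
  refine div_le_of_le_mul₀ (sq_nonneg _) hb ?_
  have e : (RCLike.re (inner ℝ (Matrix.toEuclideanCLM (n := Fin n) (𝕜 := ℝ) M x) x) : ℝ) =
      star (⇑x) ⬝ᵥ M.mulVec (⇑x) := by
    rw [real_inner_comm, Matrix.inner_toEuclideanCLM]
    simp
  have hx : star (⇑x) ⬝ᵥ (⇑x) = ‖x‖ ^ 2 := by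
    rw [EuclideanSpace.real_norm_sq_eq]
    simp [dotProduct, sq]
  have k1 := h1.dotProduct_mulVec_nonneg (⇑x)
  have k2 := h2.dotProduct_mulVec_nonneg (⇑x)
  rw [Matrix.sub_mulVec, dotProduct_sub, Matrix.smul_mulVec, Matrix.one_mulVec, dotProduct_smul,
    smul_eq_mul, hx] at k1
  rw [Matrix.add_mulVec, dotProduct_add, Matrix.smul_mulVec, Matrix.one_mulVec, dotProduct_smul,
    smul_eq_mul, hx] at k2
  rw [e, abs_le]
  constructor <;> linarith

section MeanDeviation

variable {Ω : Type*} [MeasurableSpace Ω] {μ : Measure Ω}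

theorem integral_sq_average_min_sub_le [IsProbabilityMeasure μ] {N : ℕ} {Y : Fin N → Ω → ℝ}
    (hind : iIndepFun Y μ) (hm : ∀ i, Measurable (Y i)) (h0 : ∀ i ω, 0 ≤ Y i ω)
    (hi : ∀ i, Integrable (Y i) μ) (h1 : ∀ i, ∫ ω, Y i ω ∂μ = 1) {T : ℝ} (hT : 0 < T) :
    Integrable (fun ω => (∑ i, (min (Y i ω) T - ∫ ω', min (Y i ω') T ∂μ)) ^ 2) μ ∧
      ∫ ω, (∑ i, (min (Y i ω) T - ∫ ω', min (Y i ω') T ∂μ)) ^ 2 ∂μ ≤ N * T := by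
  set Z : Fin N → Ω → ℝ := fun i ω => min (Y i ω) T with hZ
  have hZm : ∀ i, Measurable (Z i) := fun i => (hm i).min measurable_const
  have hZ0 : ∀ i ω, 0 ≤ Z i ω := fun i ω => le_min (h0 i ω) hT.le
  have hZT : ∀ i ω, Z i ω ≤ T := fun i ω => min_le_right _ _
  have hZL : ∀ i, MemLp (Z i) 2 μ := fun i =>
    MemLp.of_bound (hZm i).aestronglyMeasurable T (ae_of_all _ fun ω => by
      rw [Real.norm_eq_abs, abs_of_nonneg (hZ0 i ω)]; exact hZT i ω)
  have hZi : ∀ i, Integrable (Z i) μ := fun i => (hZL i).integrable (by norm_num)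
  have hSL : MemLp (∑ i, Z i) 2 μ := memLp_finsetSum' _ fun i _ => hZL i
  have hmean : ∫ ω, (∑ i, Z i) ω ∂μ = ∑ i, ∫ ω, Z i ω ∂μ := by
    simp only [Finset.sum_apply]
    exact integral_finsetSum _ fun i _ => hZi i
  have e : (fun ω => (∑ i, (Z i ω - ∫ ω', Z i ω' ∂μ)) ^ 2) =
      fun ω => ((∑ i, Z i) ω - ∫ ω', (∑ i, Z i) ω' ∂μ) ^ 2 := by
    ext ω
    rw [Finset.sum_sub_distrib, hmean, Finset.sum_apply]
  have hvar := variance_eq_integral (μ := μ) hSL.aemeasurable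
  refine ⟨by rw [e]; exact (hSL.sub (memLp_const _)).integrable_sq, ?_⟩
  rw [e, ← hvar, IndepFun.variance_sum (fun i _ => hZL i) (fun i _ j _ hij => by
    have := hind.indepFun hij
    exact this.comp (φ := fun x => min x T) (ψ := fun x => min x T)
      (measurable_id.min measurable_const) (measurable_id.min measurable_const))]
  have hone : ∀ i, Var[Z i; μ] ≤ T := by
    intro i
    refine (variance_le_expectation_sq (hZm i).aestronglyMeasurable).trans ?_
    calc ∫ ω, (Z i ^ 2) ω ∂μ ≤ ∫ ω, T * Y i ω ∂μ := by
          refine integral_mono (hZL i).integrable_sq ((hi i).const_mul T) fun ω => ?_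
          have h2 : Z i ω ≤ Y i ω := min_le_left _ _
          simp only [Pi.pow_apply, sq]
          exact mul_le_mul (hZT i ω) h2 (hZ0 i ω) hT.le
      _ = T := by rw [integral_const_mul, h1, mul_one]
  calc ∑ i, Var[Z i; μ] ≤ ∑ _i : Fin N, T := Finset.sum_le_sum fun i _ => hone i
    _ = N * T := by simp

/-- Only tails of order `1 + η` are at hand, so variances may be infinite and `Y i` is truncated at
`T`. The fluctuation of the truncated part, the excess, and the mean of the excess cost `e` each. -/
theorem integral_abs_average_sub_one_le [IsProbabilityMeasure μ] {N : ℕ} (hN : 0 < N)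
    {Y : Fin N → Ω → ℝ} (hind : iIndepFun Y μ) (hm : ∀ i, Measurable (Y i))
    (h0 : ∀ i ω, 0 ≤ Y i ω) (hi : ∀ i, Integrable (Y i) μ) (h1 : ∀ i, ∫ ω, Y i ω ∂μ = 1)
    {T e : ℝ} (hT : 0 < T) (he : 0 < e) (hTN : T ≤ e ^ 2 * N)
    (hex : ∀ i, Integrable (fun ω => max (Y i ω - T) 0) μ ∧
      ∫ ω, max (Y i ω - T) 0 ∂μ ≤ e) :
    Integrable (fun ω => |(1 / (N : ℝ)) * ∑ i, Y i ω - 1|) μ ∧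
      ∫ ω, |(1 / (N : ℝ)) * ∑ i, Y i ω - 1| ∂μ ≤ 3 * e := by
  have hN0 : (0 : ℝ) < N := by exact_mod_cast hN
  obtain ⟨hVi, hV⟩ := integral_sq_average_min_sub_le hind hm h0 hi h1 hT
  set V : Ω → ℝ := fun ω => ∑ i, (min (Y i ω) T - ∫ ω', min (Y i ω') T ∂μ) with hVd
  have hsplit : ∀ i ω, Y i ω = min (Y i ω) T + max (Y i ω - T) 0 := by
    intro i ω
    rcases le_total (Y i ω) T with h | h
    · rw [min_eq_left h, max_eq_right (by linarith)]; ring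
    · rw [min_eq_right h, max_eq_left (by linarith)]; ring
  have hmini : ∀ i, Integrable (fun ω => min (Y i ω) T) μ := fun i =>
    ((hi i).sub (hex i).1).congr (ae_of_all _ fun ω => by
      have := hsplit i ω
      simp only [Pi.sub_apply]
      linarith)
  have hmean : ∀ i, ∫ ω, min (Y i ω) T ∂μ = 1 - ∫ ω, max (Y i ω - T) 0 ∂μ := by
    intro i
    have h2 := integral_add (hmini i) (hex i).1
    have h3 : ∫ ω, Y i ω ∂μ = ∫ ω, (min (Y i ω) T + max (Y i ω - T) 0) ∂μ :=
      integral_congr_ae (ae_of_all _ fun ω => hsplit i ω)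
    rw [h1 i, h2] at h3
    linarith
  set R : Ω → ℝ := fun ω => ∑ i, max (Y i ω - T) 0 with hR
  have hRi : Integrable R μ := integrable_finsetSum _ fun i _ => (hex i).1
  have hRv : ∫ ω, R ω ∂μ ≤ N * e := by
    rw [hR, integral_finsetSum _ fun i _ => (hex i).1]
    calc _ ≤ ∑ _i : Fin N, e := Finset.sum_le_sum fun i _ => (hex i).2
      _ = N * e := by simp
  have hR0 : ∀ ω, 0 ≤ R ω := fun ω => Finset.sum_nonneg fun i _ => le_max_right _ _
  have hdec : ∀ ω, (1 / (N : ℝ)) * ∑ i, Y i ω - 1 = (V ω + R ω - ∫ ω', R ω' ∂μ) / N := by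
    intro ω
    have h2 : ∑ i, Y i ω = V ω + R ω + (N - ∫ ω', R ω' ∂μ) := by
      have h3 : ∫ ω', R ω' ∂μ = ∑ i, ∫ ω', max (Y i ω' - T) 0 ∂μ :=
        integral_finsetSum _ fun i _ => (hex i).1
      rw [h3, hVd, hR]
      simp only [hmean, Finset.sum_sub_distrib]
      rw [Finset.sum_congr rfl fun i _ => hsplit i ω, Finset.sum_add_distrib]
      simp only [Finset.sum_const, Finset.card_univ, Fintype.card_fin, nsmul_eq_mul, mul_one]
      ring
    rw [h2]
    field_simp
    ring
  have hb : ∀ ω, |(1 / (N : ℝ)) * ∑ i, Y i ω - 1| ≤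
      (V ω ^ 2 / (N ^ 2 * e) + e) / 2 + R ω / N + e := by
    intro ω
    -- AM-GM, used pointwise in place of Cauchy–Schwarz; its mean is at most `e` because `E V ^ 2 ≤
    -- N T ≤ e ^ 2 N ^ 2`.
    have hVb : |V ω| / N ≤ (V ω ^ 2 / (N ^ 2 * e) + e) / 2 := by
      have h2 : V ω ^ 2 / (N ^ 2 * e) = (|V ω| / N) ^ 2 / e := by
        rw [div_pow, sq_abs]; field_simp
      have h3 : (|V ω| / N) ^ 2 / e + e - 2 * (|V ω| / N) = (|V ω| / N - e) ^ 2 / e := by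
        field_simp; ring
      have h4 : 0 ≤ (|V ω| / N - e) ^ 2 / e := by positivity
      rw [h2]
      linarith
    rw [hdec, abs_div, abs_of_pos hN0]
    have hI0 : 0 ≤ ∫ ω', R ω' ∂μ := integral_nonneg hR0
    have h5 : |V ω + R ω - ∫ ω', R ω' ∂μ| ≤ |V ω| + R ω + N * e := by
      have a1 := le_abs_self (V ω)
      have a2 := neg_abs_le (V ω)
      have a3 := hR0 ω
      rw [abs_le]
      constructor <;> linarith
    calc _ ≤ (|V ω| + R ω + N * e) / N := by gcongr
      _ = |V ω| / N + R ω / N + e := by field_simp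
      _ ≤ _ := by linarith
  have hAi : Integrable (fun ω => |(1 / (N : ℝ)) * ∑ i, Y i ω - 1|) μ :=
    (((integrable_finsetSum _ fun i _ => hi i).const_mul _).sub (integrable_const 1)).abs
  refine ⟨hAi, ?_⟩
  have hB1 : Integrable (fun ω => (V ω ^ 2 / (N ^ 2 * e) + e) / 2) μ :=
    ((hVi.div_const _).add (integrable_const e)).div_const 2
  have hB2 : Integrable (fun ω => R ω / N) μ := hRi.div_const _
  refine (integral_mono hAi ((hB1.add hB2).add (integrable_const e)) hb).trans ?_
  have e1 : ∫ ω, ((V ω ^ 2 / (N ^ 2 * e) + e) / 2 + R ω / N + e) ∂μ =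
      ((∫ ω, V ω ^ 2 ∂μ) / (N ^ 2 * e) + e) / 2 + (∫ ω, R ω ∂μ) / N + e := by
    have e2 : ∫ ω, (V ω ^ 2 / (N ^ 2 * e) + e) / 2 ∂μ =
        ((∫ ω, V ω ^ 2 ∂μ) / (N ^ 2 * e) + e) / 2 := by
      rw [integral_div, integral_add (hVi.div_const _) (integrable_const e), integral_div,
        integral_const]
      simp only [probReal_univ, smul_eq_mul, one_mul]
      rfl
    have e3 : ∫ ω, ((V ω ^ 2 / (N ^ 2 * e) + e) / 2 + R ω / N) ∂μ =
        ((∫ ω, V ω ^ 2 ∂μ) / (N ^ 2 * e) + e) / 2 + (∫ ω, R ω ∂μ) / N := by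
      rw [integral_add hB1 hB2, e2, integral_div]
    rw [integral_add (f := fun ω => (V ω ^ 2 / (N ^ 2 * e) + e) / 2 + R ω / N)
      (hB1.add hB2) (integrable_const e), e3]
    simp
  refine e1.trans_le ?_
  have b1 : (∫ ω, V ω ^ 2 ∂μ) / (N ^ 2 * e) ≤ e := by
    rw [div_le_iff₀ (by positivity)]
    calc _ ≤ N * T := hV
      _ ≤ N * (e ^ 2 * N) := by gcongr
      _ = _ := by ring
  have b2 : (∫ ω, R ω ∂μ) / N ≤ e := by
    rw [div_le_iff₀ hN0]; linarith
  linarith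

variable {n : ℕ} {X : Ω → Euc n} {C η : ℝ}

theorem orthonormal_const_unit {v : Euc n} (hv : ‖v‖ = 1) :
    Orthonormal ℝ (fun _ : Unit => v) :=
  ⟨fun _ => hv, fun i j hij => absurd (Subsingleton.elim i j) hij⟩

/-- Isotropy together with strong regularity bounds the regularity constant from below. -/
theorem one_third_le_mul_one_add [NeZero n] [IsProbabilityMeasure μ] (hXm : Measurable X)
    (hX : IsIsotropic μ X) (hSR : StrongRegularity μ C η X) (hC : 0 < C) (hη : 0 < η) :
    1 / 3 ≤ C * (1 + 1 / η) := by
  by_contra! hcon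
  set α := 1 + 1 / η with hα
  have hα1 : 1 < α := by rw [hα]; have := one_div_pos.2 hη; linarith
  have hα0 : 0 < α := by linarith
  set v : Euc n := EuclideanSpace.single 0 1 with hv
  have hv1 : ‖v‖ = 1 := by simp [hv]
  -- If the claim fails, the tail bound already holds from the level `1 / α < 1`, which leaves too
  -- little mass for a coordinate of second moment one.
  have hCα : C < 1 / α := by rw [lt_div_iff₀ hα0]; linarith
  have hYm : Measurable fun ω => inner ℝ v (X ω) ^ 2 :=
    (by fun_prop : Continuous fun x : Euc n => inner ℝ v x ^ 2).measurable.comp hXm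
  have htail : ∀ t, 1 / α ≤ t → μ.real {ω | t < inner ℝ v (X ω) ^ 2} ≤ C * t ^ (-1 - η) := by
    intro t ht
    have := hSR.measureReal_sum_inner_sq hC (orthonormal_const_unit hv1) Finset.univ (t := t)
      (by simp; linarith)
    simpa using this
  obtain ⟨hi, hb⟩ := integral_excess_le hYm hC.le (one_div_pos.2 hα0) hη htail
  obtain ⟨hYi, hY1⟩ := hX.integral_inner_sq v
  rw [hv1, one_pow] at hY1
  have hle : ∫ ω, inner ℝ v (X ω) ^ 2 ∂μ ≤ 1 / α + ∫ ω, max (inner ℝ v (X ω) ^ 2 - 1 / α) 0 ∂μ := by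
    have h1 : ∫ ω, (1 / α + max (inner ℝ v (X ω) ^ 2 - 1 / α) 0) ∂μ =
        1 / α + ∫ ω, max (inner ℝ v (X ω) ^ 2 - 1 / α) 0 ∂μ := by
      rw [integral_add (integrable_const _) hi]; simp
    rw [← h1]
    refine integral_mono hYi ((integrable_const _).add hi) fun ω => ?_
    have := le_max_left (inner ℝ v (X ω) ^ 2 - 1 / α) 0
    change inner ℝ v (X ω) ^ 2 ≤ 1 / α + max (inner ℝ v (X ω) ^ 2 - 1 / α) 0
    linarith
  have hexp : (1 / α) ^ (-η) ≤ 3 := by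
    rw [Real.rpow_neg (by positivity), ← Real.inv_rpow (by positivity), one_div, inv_inv]
    calc α ^ η ≤ (Real.exp (1 / η)) ^ η := by
          refine Real.rpow_le_rpow hα0.le ?_ hη.le
          have := Real.add_one_le_exp (1 / η)
          linarith
      _ = Real.exp 1 := by rw [← Real.exp_mul]; congr 1; field_simp
      _ ≤ 3 := by have := Real.exp_one_lt_d9; linarith
  have h2 : C * (1 / α) ^ (-η) / η ≤ C * 3 / η := by gcongr
  have h3 : 1 - 1 / α = 1 / (1 + η) := by rw [hα]; field_simp; ring
  have h4 : 1 / (1 + η) ≤ C * 3 / η := by linarith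
  rw [div_le_div_iff₀ (by linarith) hη] at h4
  have h5 : C * α * η = C * (1 + η) := by rw [hα]; field_simp; ring
  nlinarith

end MeanDeviation

/-! ### Numerical constants -/

section Constants

theorem mainConst_ge {C η : ℝ} (hC : 0 < C) (hη : 0 < η) :
    50 * (288 * (C * (1 + 1 / η))) ^ (2 * (1 + 1 / η)) ≤ mainConst C η := by
  set α := 1 + 1 / η with hα
  have hα1 : 1 < α := by rw [hα]; have := one_div_pos.2 hη; linarith
  have h6 : 1 ≤ 6 * α := by linarith
  have e1 : 2 + 2 / η = 2 * α := by rw [hα]; ring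
  have e2 : 1 + 4 / η = 2 * α + (2 * α - 3) := by rw [hα]; ring
  have e3 : 6 + 6 / η = 6 * α := by rw [hα]; ring
  have e4 : (48 * C) ^ (2 * α) * (6 * α) ^ (2 * α) = (288 * (C * α)) ^ (2 * α) := by
    rw [← Real.mul_rpow (by positivity) (by positivity),
      show 48 * C * (6 * α) = 288 * (C * α) by ring]
  rw [mainConst, e1, e2, e3, Real.rpow_add (by linarith), mul_assoc 512, ← mul_assoc (_ ^ _), e4]
  -- The exponent is negative only for `α < 3 / 2`, where it exceeds `-1` and the base is at most 9.
  -- Then `512 / 9 ≥ 50`.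
  have hlow : 1 / 9 ≤ (6 * α) ^ (2 * α - 3) := by
    rcases le_total (3 / 2) α with h | h
    · have := Real.one_le_rpow h6 (show 0 ≤ 2 * α - 3 by linarith)
      linarith
    · calc (1 : ℝ) / 9 ≤ (6 * α) ^ (-1 : ℝ) := by
            rw [Real.rpow_neg_one, ← one_div]
            exact one_div_le_one_div_of_le (by linarith) (by linarith)
        _ ≤ _ := Real.rpow_le_rpow_of_exponent_le h6 (by linarith)
  have hp : 0 ≤ (288 * (C * α)) ^ (2 * α) := by positivity
  nlinarith

theorem threshold_conditions {C η ε T : ℝ} (hC : 0 < C) (hη : 0 < η) (hε0 : 0 < ε) (hε1 : ε < 1)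
    (hCα : 1 / 3 ≤ C * (1 + 1 / η)) (hT : mainConst C η * ε ^ (-(2 / η)) / 400 ≤ T) :
    16 * C ≤ T ∧ 4 * C * 8 ^ (1 + η) * (1 + 1 / η) * T ^ (-η) ≤ ε / 20 := by
  have hmc := mainConst_ge hC hη
  set α := 1 + 1 / η with hα
  have hα1 : 1 < α := by rw [hα]; have := one_div_pos.2 hη; linarith
  set R := 288 * (C * α) with hR
  have hR64 : 64 ≤ R := by rw [hR]; linarith
  have hR0 : 0 < R := by linarith
  have hα0 : 0 < α := by linarith
  have hCR : 288 * C ≤ R := by rw [hR]; nlinarith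
  have hεpow : 1 ≤ ε ^ (-(2 / η)) :=
    Real.one_le_rpow_of_pos_of_le_one_of_nonpos hε0 hε1.le (by
      have := div_pos two_pos hη; linarith)
  have hT8 : R ^ (2 * α) * ε ^ (-(2 / η)) / 8 ≤ T := by
    refine le_trans ?_ hT
    have : 50 * R ^ (2 * α) * ε ^ (-(2 / η)) ≤ mainConst C η * ε ^ (-(2 / η)) := by gcongr
    linarith
  have hpos : 0 < R ^ (2 * α) * ε ^ (-(2 / η)) / 8 := by positivity
  constructor
  · refine le_trans ?_ hT8
    have h1 : R ^ (2 : ℝ) ≤ R ^ (2 * α) :=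
      Real.rpow_le_rpow_of_exponent_le (by linarith) (by linarith)
    have h2 : R ^ (2 : ℝ) = R * R := by rw [Real.rpow_two]; ring
    have h3 : 64 * (288 * C) ≤ R * R := by gcongr
    have h4 : R ^ (2 * α) ≤ R ^ (2 * α) * ε ^ (-(2 / η)) :=
      le_mul_of_one_le_right (by positivity) hεpow
    have h5 := h3.trans (h2.symm.le.trans (h1.trans h4))
    rw [le_div_iff₀ (by norm_num)]
    exact le_trans (by linarith) h5
  -- The exponent `2 α` is chosen so that `2 α η = 2 (1 + η)`: one factor `R ^ (-(1 + η))` absorbs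
  -- the powers of 8, as `R ≥ 64`, and the other absorbs `C α`.
  · have hpow : T ^ (-η) ≤ (R ^ (1 + η))⁻¹ * (R ^ (1 + η))⁻¹ * ε ^ 2 * 8 ^ η := by
      refine (Real.rpow_le_rpow_of_nonpos hpos hT8 (by linarith)).trans (le_of_eq ?_)
      have hαη : 2 * α * -η = -(1 + η) + -(1 + η) := by rw [hα]; field_simp; ring
      rw [Real.div_rpow (by positivity) (by norm_num), Real.mul_rpow (by positivity) (by positivity),
        ← Real.rpow_mul hR0.le, ← Real.rpow_mul hε0.le, hαη, Real.rpow_add hR0,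
        Real.rpow_neg hR0.le, show -(2 / η) * -η = (2 : ℝ) by field_simp, Real.rpow_two,
        Real.rpow_neg (by norm_num : (0 : ℝ) ≤ 8), div_inv_eq_mul]
    have h64 : (64 : ℝ) ^ (1 + η) ≤ R ^ (1 + η) :=
      Real.rpow_le_rpow (by norm_num) hR64 (by linarith)
    have hRR : R ≤ R ^ (1 + η) := by
      calc R = R ^ (1 : ℝ) := (Real.rpow_one R).symm
        _ ≤ _ := Real.rpow_le_rpow_of_exponent_le (by linarith) (by linarith)
    have h88 : (8 : ℝ) ^ (1 + η) * 8 ^ η = 64 ^ (1 + η) / 8 := by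
      rw [show (64 : ℝ) = 8 * 8 by norm_num, Real.mul_rpow (by norm_num) (by norm_num),
        show (8 : ℝ) ^ η = 8 ^ (1 + η) / 8 by
          rw [Real.rpow_add (by norm_num), Real.rpow_one]; ring]
      ring
    set r := R ^ (1 + η) with hr
    have hr0 : 0 < r := by positivity
    have hε2 : ε ^ 2 ≤ ε := by nlinarith
    calc 4 * C * 8 ^ (1 + η) * α * T ^ (-η)
        ≤ 4 * C * 8 ^ (1 + η) * α * (r⁻¹ * r⁻¹ * ε ^ 2 * 8 ^ η) := by gcongr
      _ = 4 * (C * α) * (8 ^ (1 + η) * 8 ^ η) * (r⁻¹ * r⁻¹) * ε ^ 2 := by ring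
      _ = (R / 576) * 64 ^ (1 + η) * (r⁻¹ * r⁻¹) * ε ^ 2 := by rw [h88, hR]; ring
      _ ≤ (r / 576) * r * (r⁻¹ * r⁻¹) * ε := by gcongr
      _ = ε / 576 := by field_simp
      _ ≤ ε / 20 := by linarith

end Constants

end CovEst

/-! ### Assembly -/

namespace CovEst

variable {n N : ℕ}

theorem continuous_specNorm : Continuous (specNorm : Matrix (Fin n) (Fin n) ℝ → ℝ) := by
  have h := LinearMap.continuous_of_finiteDimensional
    (Matrix.toEuclideanCLM (n := Fin n) (𝕜 := ℝ)).toAlgEquiv.toLinearMap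
  exact h.norm

theorem continuous_sampleCov : Continuous (sampleCov : (Fin N → Euc n) → Matrix (Fin n) (Fin n) ℝ) := by
  refine continuous_matrix fun j k => ?_
  simp only [sampleCov, Matrix.smul_apply, Matrix.sum_apply, outer, Matrix.of_apply]
  fun_prop

/-- The two soft edges and one diagonal entry control the deviation of the sample covariance
from the identity. -/
theorem specNorm_sampleCov_sub_one_le [NeZero n] (hN : 0 < N) {φ : ℝ} (hφ : 0 < φ)
    (x : Fin N → Euc n) :
    specNorm (sampleCov x - 1) ≤
      softEdge φ (∑ i, (1 : ℝ) • outer (x i)) / N + softEdge φ (∑ i, (-1 : ℝ) • outer (x i)) / N +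
        |(1 / (N : ℝ)) * ∑ i, x i 0 ^ 2 - 1| := by
  have hN0 : (0 : ℝ) < N := by exact_mod_cast hN
  have p1 := posSemidef_softEdge_sub hφ
    (isHermitian_sum_smul_outer (Finset.univ : Finset (Fin N)) 1 x)
  have p2 := posSemidef_softEdge_sub hφ
    (isHermitian_sum_smul_outer (Finset.univ : Finset (Fin N)) (-1) x)
  set U₁ := softEdge φ (∑ i, (1 : ℝ) • outer (x i))
  set U₂ := softEdge φ (∑ i, (-1 : ℝ) • outer (x i))
  have d1 := p1.diag_nonneg (i := 0)
  have d2 := p2.diag_nonneg (i := 0)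
  simp only [← Finset.smul_sum] at p1 p2 d1 d2
  have hZ : (∑ i, outer (x i)) 0 0 = ∑ i, x i 0 ^ 2 := by
    simp [Matrix.sum_apply, outer, sq]
  simp only [Matrix.sub_apply, Matrix.smul_apply, Matrix.one_apply_eq, smul_eq_mul, mul_one,
    one_mul, hZ] at d1 d2
  set Z := (1 / (N : ℝ)) * ∑ i, x i 0 ^ 2 with hZd
  have hNZ : ∑ i, x i 0 ^ 2 = N * Z := by rw [hZd]; field_simp
  rw [hNZ] at d1 d2
  have z1 : Z ≤ U₁ / N := by rw [le_div_iff₀ hN0]; linarith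
  -- `Z` lies between `-U₂ / N` and `U₁ / N`, so each edge can be discarded on the side where the
  -- other is used, up to `|Z - 1|`.
  have z2 : -Z ≤ U₂ / N := by rw [le_div_iff₀ hN0]; linarith
  have a1 := le_abs_self (Z - 1)
  have a2 := neg_abs_le (Z - 1)
  have hinv : (0 : ℝ) ≤ 1 / N := by positivity
  refine specNorm_le_of_le (by linarith) ?_ ?_
  · have hc : 0 ≤ U₂ / N + |Z - 1| + 1 := by linarith
    have := (p1.smul hinv).add (Matrix.PosSemidef.one.smul hc)
    convert this using 1
    rw [sampleCov, one_smul, smul_sub, smul_smul]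
    module
  · have hc : 0 ≤ U₁ / N + |Z - 1| - 1 := by linarith
    have := (p2.smul hinv).add (Matrix.PosSemidef.one.smul hc)
    convert this using 1
    rw [sampleCov, neg_one_smul, smul_sub, smul_smul]
    module

theorem integral_excess_inner_sq_le {Ω : Type*} [MeasurableSpace Ω] {μ : Measure Ω}
    [IsFiniteMeasure μ] {X : Ω → Euc n} {C η e T : ℝ} (hXm : Measurable X)
    (hSR : StrongRegularity μ C η X) (hC : 0 < C) (hη : 0 < η) {v : Euc n} (hv : ‖v‖ = 1)
    (hT : 16 * C ≤ T) (herr : 4 * C * 8 ^ (1 + η) * (1 + 1 / η) * T ^ (-η) ≤ e) :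
    Integrable (fun ω => max (inner ℝ v (X ω) ^ 2 - T) 0) μ ∧
      ∫ ω, max (inner ℝ v (X ω) ^ 2 - T) 0 ∂μ ≤ e := by
  have hT0 : 0 < T := by linarith
  have hYm : Measurable fun ω => inner ℝ v (X ω) ^ 2 :=
    (by fun_prop : Continuous fun x : Euc n => inner ℝ v x ^ 2).measurable.comp hXm
  have htail : ∀ t, T ≤ t → μ.real {ω | t < inner ℝ v (X ω) ^ 2} ≤
      4 * C * 8 ^ (1 + η) * t ^ (-1 - η) := by
    intro t ht
    have ht0 : 0 < t := by linarith
    have h1 := hSR.measureReal_weighted_sum_of_le hC hη (orthonormal_const_unit hv)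
      (w := fun _ => 1) (fun _ => one_pos) one_pos (fun _ => le_rfl) (s := 1) (by simp)
      (t := t) ht0 (by linarith)
    simp only [one_mul, mul_one, Finset.univ_unique, Finset.sum_singleton] at h1
    rw [div_rpow_eq (by norm_num) ht0] at h1
    refine h1.trans ?_
    have := Real.rpow_le_rpow (by norm_num) (by norm_num : (4 : ℝ) ≤ 8) (by linarith : 0 ≤ 1 + η)
    rw [← mul_assoc]
    gcongr
    norm_num
  obtain ⟨hi, hb⟩ := integral_excess_le hYm (by positivity) hT0 hη htail
  refine ⟨hi, hb.trans (le_trans ?_ herr)⟩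
  have : 0 ≤ 4 * C * 8 ^ (1 + η) * T ^ (-η) := by positivity
  calc _ = 4 * C * 8 ^ (1 + η) * T ^ (-η) * (1 / η) := by ring
    _ ≤ 4 * C * 8 ^ (1 + η) * T ^ (-η) * (1 + 1 / η) := by gcongr; linarith
    _ = _ := by ring

end CovEst

theorem theorem1p1 {Ω : Type*} [MeasurableSpace Ω] (μ : Measure Ω) [IsProbabilityMeasure μ]
    (n N : ℕ) (X : Fin N → Ω → CovEst.Euc n) (C η ε : ℝ)
    (hmeas : ∀ i, Measurable (X i))
    (hindep : iIndepFun X μ)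
    (hiso : ∀ i, CovEst.IsIsotropic μ (X i))
    (hC : 0 < C) (hη : 0 < η)
    (hSR : ∀ i, CovEst.StrongRegularity μ C η (X i))
    (hε0 : 0 < ε) (hε1 : ε < 1)
    (hN : CovEst.mainConst C η * ε ^ (-2 - 2 / η) * (n : ℝ) ≤ (N : ℝ)) :
    Integrable (fun ω => CovEst.specNorm (CovEst.sampleCov (fun i => X i ω) - 1)) μ ∧
      ∫ ω, CovEst.specNorm (CovEst.sampleCov (fun i => X i ω) - 1) ∂μ ≤ ε := by
  have hmS : AEStronglyMeasurable
      (fun ω => CovEst.specNorm (CovEst.sampleCov (fun i => X i ω) - 1)) μ :=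
    ((CovEst.continuous_specNorm.comp
      (CovEst.continuous_sampleCov.sub continuous_const)).measurable.comp
        (measurable_pi_lambda _ hmeas)).aestronglyMeasurable
  rcases Nat.eq_zero_or_pos n with rfl | hn
  · have h0 : ∀ M : Matrix (Fin 0) (Fin 0) ℝ, CovEst.specNorm M = 0 := fun M => by
      rw [Subsingleton.elim M 0]
      simp [CovEst.specNorm]
    simp [h0, hε0.le]
  have : NeZero n := ⟨hn.ne'⟩
  have hn0 : (0 : ℝ) < n := by exact_mod_cast hn
  have hK : 0 < CovEst.mainConst C η := by
    unfold CovEst.mainConst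
    positivity
  have hN0 : (0 : ℝ) < N := lt_of_lt_of_le (by positivity) hN
  have hNpos : 0 < N := by exact_mod_cast hN0
  set e := ε / 20 with he
  have he0 : 0 < e := by positivity
  -- With `φ = e / T` this makes the starting edge `n / φ` equal to `e N`, one more `e` per step. It
  -- also gives `T ≤ e ^ 2 N`, as the variance bound requires.
  set T := e ^ 2 * N / n with hTd
  have hT0 : 0 < T := by positivity
  have hTlow : CovEst.mainConst C η * ε ^ (-(2 / η)) / 400 ≤ T := by
    rw [hTd, le_div_iff₀ hn0]
    have hpow : ε ^ (-(2 / η)) = ε ^ 2 * ε ^ (-2 - 2 / η) := by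
      rw [← Real.rpow_two, ← Real.rpow_add hε0]
      ring_nf
    rw [hpow, he]
    calc _ = ε ^ 2 / 400 * (CovEst.mainConst C η * ε ^ (-2 - 2 / η) * n) := by ring
      _ ≤ ε ^ 2 / 400 * N := by gcongr
      _ = _ := by ring
  obtain ⟨hT, herr⟩ := CovEst.threshold_conditions hC hη hε0 hε1
    (CovEst.one_third_le_mul_one_add (hmeas ⟨0, hNpos⟩) (hiso ⟨0, hNpos⟩) (hSR ⟨0, hNpos⟩) hC hη)
    hTlow
  have hedge := fun (s : ℝ) (hs : s = 1 ∨ s = -1) =>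
    CovEst.integral_softEdge_sum_le (φ := e / T) hmeas hindep hiso hSR hC hη he0
      (by linarith) hT rfl herr hs Finset.univ
  obtain ⟨hi1, hb1⟩ := hedge 1 (Or.inl rfl)
  obtain ⟨hi2, hb2⟩ := hedge (-1) (Or.inr rfl)
  have hnφ : (n : ℝ) / (e / T) = e * N := by rw [hTd]; field_simp
  rw [hnφ, Finset.card_univ, Fintype.card_fin] at hb1 hb2
  have hv1 : ‖(EuclideanSpace.single 0 1 : CovEst.Euc n)‖ = 1 := by simp
  have hinner : ∀ x : CovEst.Euc n, inner ℝ (EuclideanSpace.single 0 1) x = x 0 := fun x => by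
    simp [EuclideanSpace.inner_single_left]
  have hcoord : Continuous fun x : CovEst.Euc n => x 0 ^ 2 := by fun_prop
  obtain ⟨hi3, hb3⟩ := CovEst.integral_abs_average_sub_one_le (e := e) (T := T) hNpos
    (Y := fun i ω => X i ω 0 ^ 2)
    (hindep.comp (fun _ x => x 0 ^ 2) fun _ => hcoord.measurable)
    (fun i => hcoord.measurable.comp (hmeas i)) (fun i ω => sq_nonneg _)
    (fun i => by
      simpa only [hinner] using ((hiso i).integral_inner_sq (EuclideanSpace.single 0 1)).1)
    (fun i => by
      simpa only [hinner, hv1, one_pow] using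
        ((hiso i).integral_inner_sq (EuclideanSpace.single 0 1)).2)
    hT0 he0 (div_le_self (by positivity) (by exact_mod_cast hn))
    (fun i => by
      simpa only [hinner] using
        CovEst.integral_excess_inner_sq_le (hmeas i) (hSR i) hC hη hv1 hT herr)
  have hdom := fun ω =>
    CovEst.specNorm_sampleCov_sub_one_le hNpos (div_pos he0 hT0) fun i => X i ω
  have h12 := (hi1.div_const (N : ℝ)).add (hi2.div_const (N : ℝ))
  have hint := h12.add hi3
  have hi : Integrable (fun ω => CovEst.specNorm (CovEst.sampleCov (fun i => X i ω) - 1)) μ :=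
    hint.mono' hmS (ae_of_all _ fun ω => by
      rw [Real.norm_of_nonneg (show 0 ≤ CovEst.specNorm _ from norm_nonneg _)]
      exact hdom ω)
  refine ⟨hi, (integral_mono hi hint hdom).trans ?_⟩
  rw [integral_add' h12 hi3, integral_add' (hi1.div_const _) (hi2.div_const _), integral_div,
    integral_div]
  have q1 := div_le_div_of_nonneg_right hb1 hN0.le
  have q2 := div_le_div_of_nonneg_right hb2 hN0.le
  have e1 : (e * N + N * (1 + 5 * e)) / N = 1 + 6 * e := by field_simp; ring
  have e2 : (e * N + N * (-1 + 5 * e)) / N = -1 + 6 * e := by field_simp; ring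
  rw [e1] at q1
  rw [e2] at q2
  linarith
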